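/- Let $\kappa = 1/\sqrt{\pi}$ and let $n \ge 2$ be an integer. Consider the boundary value problem on $\mathbf{R}_+=[0,\infty)$ $$\eta'' = (2\kappa z\eta + \eta^2)^n, \qquad \eta'(0) = -\kappa, \qquad \lim_{z\to\infty}\eta(z) = 0,$$ for twice differentiable $\eta\colon[0,\infty)\to\mathbf{R}$ (one-sided derivatives at $0$). There exists a unique positive solution $\eta$; for even $n$ it is moreover the only solution among all real-valued functions. There are constants $\eta_0,\eta_2,\eta_4>0$ such that $$\eta(z) = \eta_0 - \kappa z + \eta_2 z^2 - \eta_4 z^4 + o(z^4) \qquad (z\to 0^+),$$ and there is a constant $\lambda_\infty\in\mathbf{R}$ such that $$\eta(z) = \frac{\lambda}{z^{\delta}} + \frac{\lambda_\infty}{z^{\delta'}} + o(z^{-\delta'}) \qquad (z\to\infty),$$ where $$\delta = \frac{n+2}{n-1}, \qquad \lambda = \left(\frac{\delta(\delta+1)}{(2\kappa)^n}\right)^{1/(n-1)},$$ $$\delta' = \begin{cases} \bigl(\sqrt{4n\delta(\delta+1)+1}-1\bigr)/2 & 2\le n\le 5,\\ 2\delta+1 & n\ge 6,\end{cases}$$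 and $\delta<\delta'$. -/

import Mathlib

open Set Filter Topology

noncomputable section

namespace ReactionFront

/-- The constant `κ = 1/√π`. -/
def kappa : ℝ := 1 / Real.sqrt Real.pi

/-- The exponent `δ = (n+2)/(n-1)`. -/
def delta (n : ℕ) : ℝ := ((n : ℝ) + 2) / ((n : ℝ) - 1)

/-- The constant `λ = (δ(δ+1)/(2κ)^n)^(1/(n-1))`. -/
def lam (n : ℕ) : ℝ :=
  (delta n * (delta n + 1) / (2 * kappa) ^ n) ^ (1 / ((n : ℝ) - 1))

/-- The exponent `δ'`: `(√(4nδ(δ+1)+1) - 1)/2` for `n ≤ 5`, and `2δ+1` for `n ≥ 6`. -/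
def delta' (n : ℕ) : ℝ :=
  if n ≤ 5 then (Real.sqrt (4 * n * delta n * (delta n + 1) + 1) - 1) / 2
  else 2 * delta n + 1

/-- `η` is a (classical) solution on `[0, ∞)` of the boundary value problem
`η'' = (2κzη + η²)^n`, `η'(0) = -κ`, `lim_{z → ∞} η(z) = 0`. Derivatives are one-sided at `0`;
the values of `η` on the negative half line are irrelevant. -/
def IsSolution (n : ℕ) (η : ℝ → ℝ) : Prop :=
  (∃ η' : ℝ → ℝ,
    (∀ z, 0 ≤ z → HasDerivWithinAt η (η' z) (Ici 0) z) ∧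
    (∀ z, 0 ≤ z →
      HasDerivWithinAt η' ((2 * kappa * z * η z + η z ^ 2) ^ n) (Ici 0) z) ∧
    η' 0 = -kappa) ∧
  Tendsto η atTop (𝓝 0)

/-- `f(x) = ∑ᵢ cᵢ x^{pᵢ} + …` near `x = 0`, with exponents `p₀ < p₁ < … < p_k`: the remainder
divided by `x^{p_k}` tends to `0` as `x → 0⁺`. -/
def HasExpansionAtZero {k : ℕ} (f : ℝ → ℝ) (c p : Fin (k + 1) → ℝ) : Prop :=
  StrictMono p ∧
  Tendsto (fun x : ℝ => 1 / x ^ p (Fin.last k) * |f x - ∑ i, c i * x ^ p i|)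
    (𝓝[>] 0) (𝓝 0)

/-- `f(x) = ∑ᵢ cᵢ x^{-pᵢ} + …` near `x = ∞`, with exponents `p₀ < p₁ < … < p_k`: the remainder
multiplied by `x^{p_k}` tends to `0` as `x → ∞`. -/
def HasExpansionAtInfinity {k : ℕ} (f : ℝ → ℝ) (c p : Fin (k + 1) → ℝ) : Prop :=
  StrictMono p ∧
  Tendsto (fun x : ℝ => x ^ p (Fin.last k) * |f x - ∑ i, c i * x ^ (-p i)|)
    atTop (𝓝 0)

end ReactionFront

end

/-!
Write `f(z, u) = (2κzu + u²)^n`. On `z ≥ 0`, `u ≥ 0` this is nonnegative and increasing in `u`, so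
that differences of nonnegative sub- and supersolutions obey the maximum principle
(`HasSecondDerivOn.nonpos_of_dirichlet`, `HasSecondDerivOn.nonpos_of_neumann`). Uniqueness follows
at once (`le_of_nonneg_solutions`); for even `n` every solution is convex, hence nonnegative
(`nonneg_of_convex`).

Existence (`exists_pos_solution`) is by monotone iteration between the subsolution `0` and the
supersolution `A (z + 1)^(-δ)` with `A` large (`exists_solution_between`). The linear step
`v'' - M² v = f(z, u) - M² u` is solved by an explicit integral formula (`neumannSol`), and is
monotone because `∂f/∂u` is bounded below the supersolution.

At infinity, let `v = η - λ z^(-δ)` and let `μ > 0` be the root of `μ(μ+1) = nδ(δ+1)`, so that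
`z^(-μ)` solves the linearised equation `v'' = μ(μ+1) z⁻² v`. Convexity of `x ↦ x^n` makes
`λ z^(-δ) + C z^(-μ)` a supersolution, and the shifts `λ (z + b)^(-δ)` are subsolutions; hence
`v = O(z^(-δ-1))` (`exists_abs_sub_leading_le`). The equation for `v` is the linearised one with a
forcing term consisting of `B z^(-2δ-3)`, which comes from `u²`, and of an error quadratic in the
relative size of `v` (`exists_remainder_le`). Barriers made of powers then replace variation of
constants: forcing of order `z^(-p-2)` gives `v = O(z^(-p))` if `p < μ`
(`abs_le_mul_rpow_neg_of_slow`), and convergence of `z^μ v` if `p > μ`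
(`exists_tendsto_rpow_mul`). One improvement step makes the quadratic error negligible, and
comparing `μ` with `2δ + 1` gives the two cases of `δ'` (`exists_expansion_atTop`).

At zero, the expansion is Taylor's formula with coefficients read off from the equation
(`isLittleO_taylor`). The sign of the last coefficient amounts to `η(0)^(2n+1) < κ²`
(`pow_lt_kappa_sq`), and is again a consequence of the maximum principle, applied to
`2κzη + η²`.
-/

/-! ### Comparison principles on a half-line -/

/-- On `[R, ∞)` the function `φ` has derivative `φ'` and second derivative `φ''`, one-sided
at `R`. -/
def HasSecondDerivOn (φ φ' φ'' : ℝ → ℝ) (R : ℝ) : Prop :=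
  ∀ z, R ≤ z → HasDerivWithinAt φ (φ' z) (Ici R) z ∧ HasDerivWithinAt φ' (φ'' z) (Ici R) z

namespace HasSecondDerivOn

variable {φ φ' φ'' ψ ψ' ψ'' : ℝ → ℝ} {R : ℝ}

theorem mono (h : HasSecondDerivOn φ φ' φ'' R) {S : ℝ} (hS : R ≤ S) :
    HasSecondDerivOn φ φ' φ'' S := fun z hz =>
  ⟨(h z (hS.trans hz)).1.mono (Ici_subset_Ici.2 hS),
    (h z (hS.trans hz)).2.mono (Ici_subset_Ici.2 hS)⟩

theorem congr_second (h : HasSecondDerivOn φ φ' φ'' R) (hψ : ∀ z, R ≤ z → φ'' z = ψ'' z) :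
    HasSecondDerivOn φ φ' ψ'' R := fun z hz =>
  ⟨(h z hz).1, hψ z hz ▸ (h z hz).2⟩

theorem sub (h : HasSecondDerivOn φ φ' φ'' R) (k : HasSecondDerivOn ψ ψ' ψ'' R) :
    HasSecondDerivOn (fun z => φ z - ψ z) (fun z => φ' z - ψ' z) (fun z => φ'' z - ψ'' z) R :=
  fun z hz => ⟨(h z hz).1.fun_sub (k z hz).1, (h z hz).2.fun_sub (k z hz).2⟩

theorem add (h : HasSecondDerivOn φ φ' φ'' R) (k : HasSecondDerivOn ψ ψ' ψ'' R) :
    HasSecondDerivOn (fun z => φ z + ψ z) (fun z => φ' z + ψ' z) (fun z => φ'' z + ψ'' z) R :=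
  fun z hz => ⟨(h z hz).1.fun_add (k z hz).1, (h z hz).2.fun_add (k z hz).2⟩

theorem const_mul (c : ℝ) (h : HasSecondDerivOn φ φ' φ'' R) :
    HasSecondDerivOn (fun z => c * φ z) (fun z => c * φ' z) (fun z => c * φ'' z) R :=
  fun z hz => ⟨(h z hz).1.const_mul c, (h z hz).2.const_mul c⟩

theorem neg (h : HasSecondDerivOn φ φ' φ'' R) :
    HasSecondDerivOn (fun z => -φ z) (fun z => -φ' z) (fun z => -φ'' z) R :=
  fun z hz => ⟨(h z hz).1.fun_neg, (h z hz).2.fun_neg⟩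

theorem sub_const (h : HasSecondDerivOn φ φ' φ'' R) (c : ℝ) :
    HasSecondDerivOn (fun z => φ z - c) φ' φ'' R :=
  fun z hz => ⟨(h z hz).1.sub_const c, (h z hz).2⟩

theorem continuousOn (h : HasSecondDerivOn φ φ' φ'' R) : ContinuousOn φ (Ici R) :=
  fun z hz => (h z hz).1.continuousWithinAt

theorem continuousOn_deriv (h : HasSecondDerivOn φ φ' φ'' R) : ContinuousOn φ' (Ici R) :=
  fun z hz => (h z hz).2.continuousWithinAt

theorem hasDerivAt (h : HasSecondDerivOn φ φ' φ'' R) {z : ℝ} (hz : R < z) :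
    HasDerivAt φ (φ' z) z := (h z hz.le).1.hasDerivAt (Ici_mem_nhds hz)

theorem hasDerivAt_deriv (h : HasSecondDerivOn φ φ' φ'' R) {z : ℝ} (hz : R < z) :
    HasDerivAt φ' (φ'' z) z := (h z hz.le).2.hasDerivAt (Ici_mem_nhds hz)

theorem deriv_le (h : HasSecondDerivOn φ φ' φ'' R) {b : ℝ} (hb : R ≤ b)
    (hconv : ∀ z ∈ Ioo R b, 0 ≤ φ'' z) : φ' R ≤ φ' b := by
  have hm : MonotoneOn φ' (Icc R b) := by
    refine monotoneOn_of_hasDerivWithinAt_nonneg (f' := φ'') (convex_Icc R b)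
      (h.continuousOn_deriv.mono Icc_subset_Ici_self) ?_ ?_
    · intro z hz
      rw [interior_Icc] at hz
      exact (h.hasDerivAt_deriv hz.1).hasDerivWithinAt
    · intro z hz
      rw [interior_Icc] at hz
      exact hconv z hz
  exact hm (left_mem_Icc.2 hb) (right_mem_Icc.2 hb) hb

theorem le_of_convex (h : HasSecondDerivOn φ φ' φ'' R) {b : ℝ} (hb : R ≤ b)
    (hconv : ∀ z ∈ Ioo R b, 0 ≤ φ'' z) (h0 : 0 ≤ φ' R) : φ R ≤ φ b := by
  have hm : MonotoneOn φ (Icc R b) := by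
    refine monotoneOn_of_hasDerivWithinAt_nonneg (f' := φ') (convex_Icc R b)
      (h.continuousOn.mono Icc_subset_Ici_self) ?_ ?_
    · intro z hz
      rw [interior_Icc] at hz
      exact (h.hasDerivAt hz.1).hasDerivWithinAt
    · intro z hz
      rw [interior_Icc] at hz
      exact h0.trans (h.deriv_le hz.1.le fun y hy => hconv y ⟨hy.1, hy.2.trans hz.2⟩)
  exact hm (left_mem_Icc.2 hb) (right_mem_Icc.2 hb) hb

/-- A function that is convex wherever it is positive, and that starts positive with nonnegative
slope, never drops below its initial value. -/
theorem le_of_convex_where_pos (h : HasSecondDerivOn φ φ' φ'' R) (hpos : 0 < φ R)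
    (h0 : 0 ≤ φ' R) (hconv : ∀ z, R ≤ z → 0 < φ z → 0 ≤ φ'' z) {z : ℝ} (hz : R ≤ z) :
    φ R ≤ φ z := by
  by_cases hS : ∃ t ∈ Icc R z, φ t ≤ 0
  · have hcl : IsCompact (Icc R z ∩ φ ⁻¹' Iic 0) :=
      isCompact_Icc.of_isClosed_subset
        ((h.continuousOn.mono Icc_subset_Ici_self).preimage_isClosed_of_isClosed
          isClosed_Icc isClosed_Iic) inter_subset_left
    obtain ⟨t, ht, ht0⟩ := hS
    obtain ⟨b, ⟨hb, hb0⟩, hleast⟩ := hcl.exists_isLeast ⟨t, ht, ht0⟩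
    have := h.le_of_convex hb.1 (fun y hy => hconv y hy.1.le ?_) h0
    · exact absurd (this.trans hb0) (not_le.2 hpos)
    · by_contra hy0
      exact absurd (hleast ⟨⟨hy.1.le, hy.2.le.trans hb.2⟩, not_lt.1 hy0⟩) (not_le.2 hy.2)
  · push Not at hS
    exact h.le_of_convex hz (fun y hy => hconv y hy.1.le (hS y ⟨hy.1.le, hy.2.le⟩)) h0

/-- If `φ` is nonpositive at every point where its slope is nonnegative, and it starts
nonpositive, it stays so: between a zero and a later positive value the slope would be positive
somewhere, at a positive value of `φ`. -/
theorem nonpos_of_slope (h : HasSecondDerivOn φ φ' φ'' R)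
    (hs : ∀ a, R ≤ a → 0 ≤ φ' a → φ a ≤ 0) (hR : φ R ≤ 0) {z : ℝ} (hz : R ≤ z) : φ z ≤ 0 := by
  by_contra hpos
  push Not at hpos
  have hcl : IsCompact (Icc R z ∩ φ ⁻¹' Iic 0) :=
    isCompact_Icc.of_isClosed_subset
      ((h.continuousOn.mono Icc_subset_Ici_self).preimage_isClosed_of_isClosed
        isClosed_Icc isClosed_Iic) inter_subset_left
  obtain ⟨a, ⟨ha, ha0⟩, hgr⟩ := hcl.exists_isGreatest ⟨R, left_mem_Icc.2 hz, hR⟩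
  have ha0 : φ a ≤ 0 := ha0
  have haz : a < z := lt_of_le_of_ne ha.2 fun e => by rw [e] at ha0; linarith
  obtain ⟨c, hc, hc'⟩ := exists_hasDerivAt_eq_slope φ φ' haz
    (h.continuousOn.mono fun y hy => ha.1.trans hy.1)
    (fun y hy => h.hasDerivAt (ha.1.trans_lt hy.1))
  have h1 : 0 ≤ φ' c := by
    rw [hc']; exact div_nonneg (by linarith) (by linarith)
  have h2 := hs c (ha.1.trans hc.1.le) h1
  exact absurd (hgr ⟨⟨ha.1.trans hc.1.le, hc.2.le⟩, h2⟩) (not_le.2 hc.1)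

/-- Comparison at a Neumann end: a function convex where positive, with nonnegative initial slope
and nonpositive limit at infinity, is nonpositive at the end point. -/
theorem nonpos_left_of_slope (h : HasSecondDerivOn φ φ' φ'' R) {L : ℝ}
    (hL : Tendsto φ atTop (𝓝 L)) (hL0 : L ≤ 0)
    (hconv : ∀ z, R ≤ z → 0 < φ z → 0 ≤ φ'' z) (h0 : 0 ≤ φ' R) : φ R ≤ 0 := by
  by_contra hpos
  push Not at hpos
  have : φ R ≤ L := ge_of_tendsto hL <| (eventually_ge_atTop R).mono fun z hz =>
    h.le_of_convex_where_pos hpos h0 hconv hz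
  linarith

/-- Maximum principle with a Dirichlet condition. -/
theorem nonpos_of_dirichlet (h : HasSecondDerivOn φ φ' φ'' R) {L : ℝ}
    (hL : Tendsto φ atTop (𝓝 L)) (hL0 : L ≤ 0)
    (hconv : ∀ z, R ≤ z → 0 < φ z → 0 ≤ φ'' z) (hR : φ R ≤ 0) {z : ℝ} (hz : R ≤ z) : φ z ≤ 0 :=
  h.nonpos_of_slope (fun _ ha ha' => (h.mono ha).nonpos_left_of_slope hL hL0
    (fun y hy => hconv y (ha.trans hy)) ha') hR hz

/-- Maximum principle with a Neumann condition. -/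
theorem nonpos_of_neumann (h : HasSecondDerivOn φ φ' φ'' R) {L : ℝ}
    (hL : Tendsto φ atTop (𝓝 L)) (hL0 : L ≤ 0)
    (hconv : ∀ z, R ≤ z → 0 < φ z → 0 ≤ φ'' z) (h0 : 0 ≤ φ' R) {z : ℝ} (hz : R ≤ z) : φ z ≤ 0 :=
  h.nonpos_of_dirichlet hL hL0 hconv (h.nonpos_left_of_slope hL hL0 hconv h0) hz

/-- Maximum principle with a Neumann condition for functions that are merely bounded above; the
zeroth-order term `c * φ` makes up for the missing limit. -/
theorem nonpos_of_neumann_of_bddAbove (h : HasSecondDerivOn φ φ' φ'' R) {B c : ℝ} (hc : 0 < c)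
    (hB : ∀ z, R ≤ z → φ z ≤ B) (hconv : ∀ z, R ≤ z → 0 < φ z → c * φ z ≤ φ'' z)
    (h0 : 0 ≤ φ' R) {z : ℝ} (hz : R ≤ z) : φ z ≤ 0 := by
  have key : ∀ a, R ≤ a → 0 ≤ φ' a → φ a ≤ 0 := by
    intro a ha ha'
    by_contra hpos
    push Not at hpos
    set m := φ a with hm
    have hge : ∀ y, a ≤ y → m ≤ φ y := fun y hy =>
      (h.mono ha).le_of_convex_where_pos hpos ha'
        (fun t ht ht0 => (mul_nonneg hc.le ht0.le).trans (hconv t (ha.trans ht) ht0)) hy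
    have hsq : HasSecondDerivOn (fun y => c * m / 2 * (y - a) ^ 2) (fun y => c * m * (y - a))
        (fun _ => c * m) a := by
      intro y _
      have e := (hasDerivAt_id y).sub_const a
      constructor
      · refine (((e.pow 2).const_mul (c * m / 2)).congr_deriv ?_).hasDerivWithinAt
        simp; ring
      · exact ((e.const_mul (c * m)).congr_deriv (by simp)).hasDerivWithinAt
    have hgrow : ∀ y, a ≤ y → m + c * m / 2 * (y - a) ^ 2 ≤ φ y := by
      intro y hy
      have := ((h.mono ha).sub hsq).le_of_convex hy (fun t ht => by
        have h1 := hge t ht.1.le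
        have h2 := hconv t (ha.trans ht.1.le) (hpos.trans_le h1)
        have h3 := mul_le_mul_of_nonneg_left h1 hc.le
        linarith) (by simpa using ha')
      simp only [sub_self, ne_eq, OfNat.ofNat_ne_zero, not_false_eq_true, zero_pow,
        mul_zero, sub_zero] at this
      linarith
    have hm_le := hB a ha
    have hB0 : 0 < B := hpos.trans_le hm_le
    have h1 := hgrow (a + (2 * B / (c * m) + 1)) (by
      have : 0 ≤ 2 * B / (c * m) := by positivity
      linarith)
    have h2 := hB (a + (2 * B / (c * m) + 1)) (by
      have : 0 ≤ 2 * B / (c * m) := by positivity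
      linarith)
    have h3 : c * m / 2 * (2 * B / (c * m)) = B := by field_simp
    have h5 : 2 * B / (c * m) ≤ (a + (2 * B / (c * m) + 1) - a) ^ 2 := by nlinarith
    have h6 := mul_le_mul_of_nonneg_left h5 (by positivity : 0 ≤ c * m / 2)
    linarith
  exact h.nonpos_of_slope key (key R le_rfl h0) hz

end HasSecondDerivOn

/-! ### The Neumann problem for `v'' = M² v - h` on the half-line -/

open MeasureTheory

section NeumannSol

open MeasureTheory

/-- The bounded solution on `[0, ∞)` of `v'' = M² v - h`, `v'(0) = -k`, written with the
exponentials `exp (± M z)`. -/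
noncomputable def neumannSol (M k : ℝ) (h : ℝ → ℝ) (z : ℝ) : ℝ :=
  k / M * Real.exp (-M * z) + 1 / (2 * M) *
    (Real.exp (-M * z) *
        ((∫ s in (0 : ℝ)..z, Real.exp (M * s) * h s) + ∫ s in Ioi (0 : ℝ), Real.exp (-M * s) * h s)
      + Real.exp (M * z) *
        ((∫ s in Ioi (0 : ℝ), Real.exp (-M * s) * h s) - ∫ s in (0 : ℝ)..z, Real.exp (-M * s) * h s))

/-- The derivative of `neumannSol`. -/
noncomputable def neumannSolDeriv (M k : ℝ) (h : ℝ → ℝ) (z : ℝ) : ℝ :=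
  -k * Real.exp (-M * z) + 1 / 2 *
    (-Real.exp (-M * z) *
        ((∫ s in (0 : ℝ)..z, Real.exp (M * s) * h s) + ∫ s in Ioi (0 : ℝ), Real.exp (-M * s) * h s)
      + Real.exp (M * z) *
        ((∫ s in Ioi (0 : ℝ), Real.exp (-M * s) * h s) - ∫ s in (0 : ℝ)..z, Real.exp (-M * s) * h s))

variable {M k B : ℝ} {h h₁ h₂ : ℝ → ℝ}

theorem integrableOn_exp_mul (hM : 0 < M) (hm : Measurable h) (hb : ∀ s, |h s| ≤ B) (a : ℝ) :
    IntegrableOn (fun s => Real.exp (-M * s) * h s) (Ioi a) := by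
  refine Integrable.mono' ((integrableOn_exp_mul_Ioi (a := -M) (by linarith) a).mul_const B)
    (by fun_prop) (ae_of_all _ fun s => ?_)
  rw [Real.norm_eq_abs, abs_mul, abs_of_pos (Real.exp_pos _)]
  exact mul_le_mul_of_nonneg_left (hb s) (Real.exp_pos _).le

theorem intervalIntegrable_exp_mul (c : ℝ) (hm : Measurable h) (hb : ∀ s, |h s| ≤ B) (a b : ℝ) :
    IntervalIntegrable (fun s => Real.exp (c * s) * h s) volume a b := by
  have hc : Continuous fun s => Real.exp (c * s) * B := by fun_prop
  refine (hc.intervalIntegrable a b).mono_fun' (by fun_prop) (ae_of_all _ fun s => ?_)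
  simp only [Real.norm_eq_abs]
  rw [abs_mul, abs_of_pos (Real.exp_pos _)]
  exact mul_le_mul_of_nonneg_left (hb s) (Real.exp_pos _).le

theorem neumannSol_eq (hM : 0 < M) (hm : Measurable h) (hb : ∀ s, |h s| ≤ B) {z : ℝ} :
    neumannSol M k h z = k / M * Real.exp (-M * z) + 1 / (2 * M) *
      (Real.exp (-M * z) * ((∫ s in (0 : ℝ)..z, Real.exp (M * s) * h s) +
          ∫ s in Ioi (0 : ℝ), Real.exp (-M * s) * h s)
        + Real.exp (M * z) * ∫ s in Ioi z, Real.exp (-M * s) * h s) := by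
  rw [neumannSol, ← intervalIntegral.integral_interval_add_Ioi
    (integrableOn_exp_mul hM hm hb 0) (integrableOn_exp_mul hM hm hb z)]
  ring

theorem neumannSol_mono (hM : 0 < M) (hm₁ : Measurable h₁) (hb₁ : ∀ s, |h₁ s| ≤ B)
    (hm₂ : Measurable h₂) (hb₂ : ∀ s, |h₂ s| ≤ B) (hle : ∀ s, h₁ s ≤ h₂ s) {z : ℝ} (hz : 0 ≤ z) :
    neumannSol M k h₁ z ≤ neumannSol M k h₂ z := by
  rw [neumannSol_eq hM hm₁ hb₁, neumannSol_eq hM hm₂ hb₂]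
  have h1 : ∀ c s : ℝ, Real.exp (c * s) * h₁ s ≤ Real.exp (c * s) * h₂ s := fun c s =>
    mul_le_mul_of_nonneg_left (hle s) (Real.exp_pos _).le
  have i1 := intervalIntegral.integral_mono_on hz (intervalIntegrable_exp_mul M hm₁ hb₁ 0 z)
    (intervalIntegrable_exp_mul M hm₂ hb₂ 0 z) (fun s _ => h1 M s)
  have i2 : ∀ a, ∫ s in Ioi a, Real.exp (-M * s) * h₁ s ≤ ∫ s in Ioi a, Real.exp (-M * s) * h₂ s :=
    fun a => integral_mono (integrableOn_exp_mul hM hm₁ hb₁ a) (integrableOn_exp_mul hM hm₂ hb₂ a)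
      (fun s => h1 (-M) s)
  have i3 := i2 0
  have i4 := i2 z
  gcongr

theorem neumannSol_zero (M k z : ℝ) :
    neumannSol M k (fun _ => 0) z = k / M * Real.exp (-M * z) := by
  simp [neumannSol]

theorem neumannSol_const_le (hM : 0 < M) (hk : 0 ≤ k) (hB : 0 ≤ B) {z : ℝ} (hz : 0 ≤ z) :
    neumannSol M k (fun _ => B) z ≤ k / M + B / M ^ 2 := by
  have hI : ∀ a, ∫ s in Ioi a, Real.exp (-M * s) * B = Real.exp (-M * a) / M * B := by
    intro a
    rw [integral_mul_const, integral_exp_mul_Ioi (by linarith)]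
    field_simp
  have hP : ∫ s in (0 : ℝ)..z, Real.exp (M * s) * B = (Real.exp (M * z) - 1) / M * B := by
    rw [intervalIntegral.integral_mul_const,
      intervalIntegral.integral_comp_mul_left (fun x => Real.exp x) hM.ne', integral_exp]
    simp only [mul_zero, Real.exp_zero, smul_eq_mul]
    ring
  have hEE : Real.exp (-M * z) * Real.exp (M * z) = 1 := by
    rw [← Real.exp_add]; simp
  have hE : Real.exp (-M * z) ≤ 1 := Real.exp_le_one_iff.2 (by nlinarith)
  have hk1 : k / M * Real.exp (-M * z) ≤ k / M * 1 :=
    mul_le_mul_of_nonneg_left hE (by positivity)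
  rw [neumannSol_eq hM measurable_const (fun _ => (abs_of_nonneg hB).le), hI, hI, hP]
  simp only [mul_zero, Real.exp_zero]
  have : 1 / (2 * M) * (Real.exp (-M * z) * ((Real.exp (M * z) - 1) / M * B + 1 / M * B)
      + Real.exp (M * z) * (Real.exp (-M * z) / M * B)) = B / M ^ 2 := by
    field_simp
    rw [neg_mul] at hEE
    linear_combination (2 * B) * hEE
  linarith

theorem tendsto_neumannSol (hM : 0 < M) {H : ℕ → ℝ → ℝ} (hm : ∀ n, Measurable (H n))
    (hb : ∀ n s, |H n s| ≤ B) (hlim : ∀ s, Tendsto (fun n => H n s) atTop (𝓝 (h s))) (z : ℝ) :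
    Tendsto (fun n => neumannSol M k (H n) z) atTop (𝓝 (neumannSol M k h z)) := by
  have hint : ∀ c : ℝ, Tendsto (fun n => ∫ s in (0 : ℝ)..z, Real.exp (c * s) * H n s) atTop
      (𝓝 (∫ s in (0 : ℝ)..z, Real.exp (c * s) * h s)) := by
    intro c
    have hc : Continuous fun s => Real.exp (c * s) * B := by fun_prop
    refine intervalIntegral.tendsto_integral_filter_of_dominated_convergence
      (fun s => Real.exp (c * s) * B) (Eventually.of_forall fun n => ?_)
      (Eventually.of_forall fun n => ae_of_all _ fun s _ => ?_) (hc.intervalIntegrable _ _)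
      (ae_of_all _ fun s _ => (hlim s).const_mul _)
    · have := hm n; fun_prop
    · rw [Real.norm_eq_abs, abs_mul, abs_of_pos (Real.exp_pos _)]
      exact mul_le_mul_of_nonneg_left (hb n s) (Real.exp_pos _).le
  have hI : Tendsto (fun n => ∫ s in Ioi (0 : ℝ), Real.exp (-M * s) * H n s) atTop
      (𝓝 (∫ s in Ioi (0 : ℝ), Real.exp (-M * s) * h s)) := by
    refine tendsto_integral_of_dominated_convergence (fun s => Real.exp (-M * s) * B)
      (fun n => ?_) ((integrableOn_exp_mul_Ioi (a := -M) (by linarith) 0).mul_const B)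
      (fun n => ae_of_all _ fun s => ?_) (ae_of_all _ fun s => (hlim s).const_mul _)
    · have := hm n; fun_prop
    · rw [Real.norm_eq_abs, abs_mul, abs_of_pos (Real.exp_pos _)]
      exact mul_le_mul_of_nonneg_left (hb n s) (Real.exp_pos _).le
  exact tendsto_const_nhds.add (((((hint M).add hI).const_mul _).add
    ((hI.sub (hint (-M))).const_mul _)).const_mul _)

theorem continuous_neumannSol (hm : Measurable h) (hb : ∀ s, |h s| ≤ B) :
    Continuous (neumannSol M k h) := by
  have hc : ∀ c : ℝ, Continuous fun z => ∫ s in (0 : ℝ)..z, Real.exp (c * s) * h s := fun c =>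
    intervalIntegral.continuous_primitive (intervalIntegrable_exp_mul c hm hb) 0
  unfold neumannSol
  fun_prop

theorem hasSecondDerivOn_neumannSol (hM : M ≠ 0) (hc : Continuous h) (R : ℝ) :
    HasSecondDerivOn (neumannSol M k h) (neumannSolDeriv M k h)
      (fun z => M ^ 2 * neumannSol M k h z - h z) R := by
  intro z _
  have hP : ∀ c : ℝ, HasDerivAt (fun z => ∫ s in (0 : ℝ)..z, Real.exp (c * s) * h s)
      (Real.exp (c * z) * h z) z := fun c => by
    have h' : Continuous fun s => Real.exp (c * s) * h s := by fun_prop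
    exact h'.integral_hasStrictDerivAt 0 z |>.hasDerivAt
  have hE : ∀ c : ℝ, HasDerivAt (fun z => Real.exp (c * z)) (c * Real.exp (c * z)) z := fun c =>
    (((hasDerivAt_id z).const_mul c).exp).congr_deriv (by simp [mul_comm])
  have hEE : Real.exp (-M * z) * Real.exp (M * z) = 1 := by
    rw [← Real.exp_add]; simp
  set I := ∫ s in Ioi (0 : ℝ), Real.exp (-M * s) * h s with hI
  constructor
  · refine HasDerivAt.hasDerivWithinAt ?_
    have := ((hE (-M)).const_mul (k / M)).fun_add
      ((((hE (-M)).fun_mul ((hP M).add_const I)).fun_add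
        ((hE M).fun_mul ((hP (-M)).const_sub I))).const_mul (1 / (2 * M)))
    refine this.congr_deriv ?_
    rw [neumannSolDeriv, ← hI]
    field_simp
    ring
  · refine HasDerivAt.hasDerivWithinAt ?_
    have := ((hE (-M)).const_mul (-k)).fun_add
      ((((hE (-M)).fun_neg.fun_mul ((hP M).add_const I)).fun_add
        ((hE M).fun_mul ((hP (-M)).const_sub I))).const_mul (1 / 2))
    refine this.congr_deriv ?_
    simp only [neumannSol, ← hI]
    field_simp
    rw [neg_mul] at hEE
    linear_combination (-2 * h z) * hEE

theorem neumannSolDeriv_zero (M k : ℝ) (h : ℝ → ℝ) : neumannSolDeriv M k h 0 = -k := by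
  simp [neumannSolDeriv]

end NeumannSol

/-! ### Monotone iteration -/

/-- Existence for `u'' = f(z, u)`, `u'(0) = -k` between the subsolution `0` and a bounded
supersolution `β`, when `M² u - f(z, u)` is increasing in `u ∈ [0, β(z)]`. The solution is the
limit of the increasing iteration that solves the linear problem
`v'' - M² v = f(z, u) - M² u` repeatedly, starting from `u = 0`. -/
theorem exists_solution_between {f : ℝ → ℝ → ℝ} {M k B : ℝ} {β β' β'' : ℝ → ℝ}
    (hf : Continuous (Function.uncurry f)) (hM : 0 < M) (hk : 0 < k)
    (hf0 : ∀ z, 0 ≤ z → f z 0 = 0)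
    (hmono : ∀ z, 0 ≤ z → ∀ u v, 0 ≤ u → u ≤ v → v ≤ β z → M ^ 2 * u - f z u ≤ M ^ 2 * v - f z v)
    (hβ : HasSecondDerivOn β β' β'' 0) (hβ0 : ∀ z, 0 ≤ z → 0 ≤ β z) (hβB : ∀ z, 0 ≤ z → β z ≤ B)
    (hfβ : ∀ z, 0 ≤ z → 0 ≤ f z (β z))
    (hsup : ∀ z, 0 ≤ z → β'' z ≤ f z (β z)) (hβk : β' 0 ≤ -k) :
    ∃ u u' : ℝ → ℝ, HasSecondDerivOn u u' (fun z => f z (u z)) 0 ∧ u' 0 = -k ∧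
      ∀ z, 0 ≤ z → 0 < u z ∧ u z ≤ β z := by
  -- Right-hand sides are extended to the negative half-line as constants.
  set G : (ℝ → ℝ) → ℝ → ℝ := fun u s => M ^ 2 * u (max s 0) - f (max s 0) (u (max s 0)) with hG
  set T : (ℝ → ℝ) → ℝ → ℝ := fun u => neumannSol M k (G u) with hT
  have hGc : ∀ u, ContinuousOn u (Ici 0) → Continuous (G u) := by
    intro u hu
    have h1 : Continuous fun s : ℝ => u (max s 0) :=
      hu.comp_continuous (by fun_prop) (fun s => mem_Ici.2 (le_max_right _ _))
    have h2 : Continuous fun s : ℝ => f (max s 0) (u (max s 0)) :=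
      hf.comp ((by fun_prop : Continuous fun s : ℝ => max s 0).prodMk h1)
    exact (h1.const_mul _).sub h2
  have hG0 : G (fun _ => 0) = fun _ => 0 := by
    funext s
    simp [hG, hf0 (max s 0) (le_max_right _ _)]
  have hGmono : ∀ u v : ℝ → ℝ, (∀ z, 0 ≤ z → 0 ≤ u z) → (∀ z, 0 ≤ z → u z ≤ v z) →
      (∀ z, 0 ≤ z → v z ≤ β z) → ∀ s, G u s ≤ G v s := fun u v h0 h1 h2 s =>
    hmono _ (le_max_right _ _) _ _ (h0 _ (le_max_right _ _)) (h1 _ (le_max_right _ _))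
      (h2 _ (le_max_right _ _))
  have hGle : ∀ u : ℝ → ℝ, (∀ z, 0 ≤ z → 0 ≤ u z) → (∀ z, 0 ≤ z → u z ≤ β z) →
      ∀ s, 0 ≤ G u s ∧ G u s ≤ M ^ 2 * B := by
    intro u h0 h1 s
    have hs : 0 ≤ max s 0 := le_max_right _ _
    constructor
    · have := hGmono (fun _ => 0) u (fun _ _ => le_rfl) h0 h1 s
      rwa [hG0] at this
    · refine (hGmono u β h0 h1 (fun _ _ => le_rfl) s).trans ?_
      have h2 := hfβ _ hs
      have h3 := mul_le_mul_of_nonneg_left (hβB _ hs) (sq_nonneg M)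
      simp only [hG]
      linarith
  have hGabs : ∀ u : ℝ → ℝ, (∀ z, 0 ≤ z → 0 ≤ u z) → (∀ z, 0 ≤ z → u z ≤ β z) →
      ∀ s, |G u s| ≤ M ^ 2 * B := fun u h0 h1 s => by
    rw [abs_of_nonneg (hGle u h0 h1 s).1]
    exact (hGle u h0 h1 s).2
  have hB : 0 ≤ B := (hβ0 0 le_rfl).trans (hβB 0 le_rfl)
  have hlow : ∀ u : ℝ → ℝ, Measurable (G u) → (∀ z, 0 ≤ z → 0 ≤ u z) →
      (∀ z, 0 ≤ z → u z ≤ β z) → ∀ z, 0 ≤ z → 0 < T u z := by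
    intro u hu h0 h1 z hz
    have := neumannSol_mono (k := k) hM measurable_const
      (fun s => by simpa using mul_nonneg (sq_nonneg M) hB) hu (hGabs u h0 h1)
      (fun s => (hGle u h0 h1 s).1) hz
    rw [neumannSol_zero] at this
    exact lt_of_lt_of_le (by positivity) this
  have hup : ∀ u : ℝ → ℝ, ContinuousOn u (Ici 0) → (∀ z, 0 ≤ z → 0 ≤ u z) →
      (∀ z, 0 ≤ z → u z ≤ β z) → ∀ z, 0 ≤ z → T u z ≤ β z := by
    intro u hu h0 h1 z hz
    have hb : ∀ y, 0 ≤ y → T u y - β y ≤ k / M + M ^ 2 * B / M ^ 2 := by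
      intro y hy
      have h2 := neumannSol_mono (k := k) hM (hGc u hu).measurable (hGabs u h0 h1)
        measurable_const (fun s => (abs_of_nonneg (mul_nonneg (sq_nonneg M) hB)).le)
        (fun s => (hGle u h0 h1 s).2) hy
      have h3 := neumannSol_const_le hM hk.le (mul_nonneg (sq_nonneg M) hB) hy
      have h4 := hβ0 y hy
      linarith
    have := ((hasSecondDerivOn_neumannSol (k := k) hM.ne' (hGc u hu) 0).sub
      hβ).nonpos_of_neumann_of_bddAbove (pow_pos hM 2) hb (fun y hy _ => ?_) ?_ hz
    · exact sub_nonpos.1 this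
    · have h2 := hGmono u β h0 h1 (fun _ _ => le_rfl) y
      have h3 := hsup y hy
      have h4 : G β y = M ^ 2 * β y - f y (β y) := by simp only [hG, max_eq_left hy]
      linarith
    · rw [neumannSolDeriv_zero]; linarith
  set U : ℕ → ℝ → ℝ := fun j => T^[j] (fun _ => 0) with hU
  have hUs : ∀ j, U (j + 1) = T (U j) := fun j => Function.iterate_succ_apply' T j _
  have hUok : ∀ j, ContinuousOn (U j) (Ici 0) ∧ ∀ z, 0 ≤ z → 0 ≤ U j z ∧ U j z ≤ β z := by
    intro j
    induction j with
    | zero => exact ⟨continuousOn_const, fun z hz => ⟨le_rfl, hβ0 z hz⟩⟩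
    | succ j ih =>
      rw [hUs]
      have h0 := fun z hz => (ih.2 z hz).1
      have h1 := fun z hz => (ih.2 z hz).2
      exact ⟨(continuous_neumannSol (hGc _ ih.1).measurable (hGabs _ h0 h1)).continuousOn,
        fun z hz => ⟨(hlow _ (hGc _ ih.1).measurable h0 h1 z hz).le, hup _ ih.1 h0 h1 z hz⟩⟩
  have hUmono : ∀ j z, 0 ≤ z → U j z ≤ U (j + 1) z := by
    intro j
    induction j with
    | zero => exact fun z hz => ((hUok 1).2 z hz).1
    | succ j ih =>
      intro z hz
      rw [hUs, hUs (j + 1)]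
      have ok := fun i => (hUok i).2
      exact neumannSol_mono hM (hGc _ (hUok j).1).measurable
        (hGabs _ (fun z hz => (ok j z hz).1) (fun z hz => (ok j z hz).2))
        (hGc _ (hUok (j + 1)).1).measurable
        (hGabs _ (fun z hz => (ok (j + 1) z hz).1) (fun z hz => (ok (j + 1) z hz).2))
        (hGmono _ _ (fun z hz => (ok j z hz).1) ih (fun z hz => (ok (j + 1) z hz).2)) hz
  set V : ℝ → ℝ := fun z => ⨆ j, U j z with hV
  have hbdd : ∀ z, 0 ≤ z → BddAbove (range fun j => U j z) := fun z hz =>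
    ⟨β z, by rintro _ ⟨j, rfl⟩; exact ((hUok j).2 z hz).2⟩
  have hUV : ∀ z, 0 ≤ z → Tendsto (fun j => U j z) atTop (𝓝 (V z)) := fun z hz =>
    tendsto_atTop_ciSup (monotone_nat_of_le_succ fun j => hUmono j z hz) (hbdd z hz)
  have hV0 : ∀ z, 0 ≤ z → 0 ≤ V z := fun z hz =>
    ge_of_tendsto' (hUV z hz) fun j => ((hUok j).2 z hz).1
  have hVβ : ∀ z, 0 ≤ z → V z ≤ β z := fun z hz =>
    le_of_tendsto' (hUV z hz) fun j => ((hUok j).2 z hz).2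
  have hGV : ∀ s, Tendsto (fun j => G (U j) s) atTop (𝓝 (G V s)) := by
    intro s
    have h1 := hUV _ (le_max_right s 0)
    have h2 : Tendsto (fun j => f (max s 0) (U j (max s 0))) atTop
        (𝓝 (f (max s 0) (V (max s 0)))) :=
      (hf.tendsto (max s 0, V (max s 0))).comp (tendsto_const_nhds.prodMk_nhds h1)
    exact (h1.const_mul _).sub h2
  have hGVm : Measurable (G V) := measurable_of_tendsto_metrizable
    (fun j => (hGc _ (hUok j).1).measurable) (tendsto_pi_nhds.2 hGV)
  have hfix : ∀ z, 0 ≤ z → V z = T V z := by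
    intro z hz
    refine tendsto_nhds_unique ((hUV z hz).comp (tendsto_add_atTop_nat 1)) ?_
    have := tendsto_neumannSol (k := k) hM (fun j => (hGc _ (hUok j).1).measurable)
      (fun j => hGabs _ (fun z hz => ((hUok j).2 z hz).1) (fun z hz => ((hUok j).2 z hz).2)) hGV z
    refine this.congr fun j => ?_
    simp only [Function.comp, hUs]
    rfl
  have hTc : Continuous (T V) := continuous_neumannSol hGVm (hGabs V hV0 hVβ)
  have hGT : G (T V) = G V := by
    funext s
    simp only [hG, hfix _ (le_max_right s 0)]
  have hGVc : Continuous (G V) := hGT ▸ hGc _ hTc.continuousOn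
  refine ⟨T V, neumannSolDeriv M k (G V), ?_, neumannSolDeriv_zero _ _ _, fun z hz =>
    ⟨hlow V hGVm hV0 hVβ z hz, (hfix z hz) ▸ hVβ z hz⟩⟩
  refine (hasSecondDerivOn_neumannSol hM.ne' hGVc 0).congr_second fun z hz => ?_
  have h1 : G V z = M ^ 2 * T V z - f z (T V z) := by
    rw [← hGT]; simp only [hG, max_eq_left hz]
  rw [h1]
  simp only [hT]
  ring

/-! ### The nonlinearity and the exponents -/

namespace ReactionFront

/-- The right-hand side `(2κzu + u²)^n` of the equation. -/
noncomputable def source (n : ℕ) (z u : ℝ) : ℝ := (2 * kappa * z * u + u ^ 2) ^ n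

theorem kappa_pos : 0 < kappa := by
  unfold kappa
  positivity

theorem delta_gt_one {n : ℕ} (hn : 2 ≤ n) : 1 < delta n := by
  have : (2 : ℝ) ≤ n := by exact_mod_cast hn
  rw [delta, lt_div_iff₀ (by linarith)]
  linarith

theorem delta_le_four {n : ℕ} (hn : 2 ≤ n) : delta n ≤ 4 := by
  have : (2 : ℝ) ≤ n := by exact_mod_cast hn
  rw [delta, div_le_iff₀ (by linarith)]
  linarith

theorem delta_add_two {n : ℕ} (hn : 2 ≤ n) : delta n + 2 = n * (delta n - 1) := by
  have : (2 : ℝ) ≤ n := by exact_mod_cast hn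
  have h : (n : ℝ) - 1 ≠ 0 := by linarith
  rw [delta]
  field_simp
  ring

theorem source_nonneg (n : ℕ) {z u : ℝ} (hz : 0 ≤ z) (hu : 0 ≤ u) : 0 ≤ source n z u := by
  have := kappa_pos
  unfold source
  positivity

theorem source_mono (n : ℕ) {z u v : ℝ} (hz : 0 ≤ z) (hu : 0 ≤ u) (huv : u ≤ v) :
    source n z u ≤ source n z v := by
  have := kappa_pos
  unfold source
  gcongr

theorem rpow_neg_delta_mul_pow {n : ℕ} (hn : 2 ≤ n) (c : ℝ) {y : ℝ} (hy : 0 < y) :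
    (c * (y * y ^ (-delta n))) ^ n = c ^ n * y ^ (-delta n - 2) := by
  have h1 : y * y ^ (-delta n) = y ^ (1 - delta n) := by
    rw [sub_eq_add_neg, Real.rpow_add hy, Real.rpow_one]
  rw [mul_pow, h1, ← Real.rpow_mul_natCast hy.le]
  congr 2
  linear_combination delta_add_two hn

theorem rpow_neg_delta_mul_pow_pred_mul {m : ℕ} (hm : 1 ≤ m) {y : ℝ} (hy : 0 < y) :
    (y * y ^ (-delta (m + 1))) ^ m * y = y ^ (-2 : ℝ) := by
  have h1 : y * y ^ (-delta (m + 1)) = y ^ (1 - delta (m + 1)) := by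
    rw [sub_eq_add_neg, Real.rpow_add hy, Real.rpow_one]
  rw [h1, ← Real.rpow_mul_natCast hy.le, ← Real.rpow_add_one hy.ne']
  congr 1
  have := delta_add_two (n := m + 1) (by omega)
  push_cast at this
  linear_combination this

/-- The tangent line of `x ↦ x ^ (m + 1)` lies below its graph on the nonnegative reals. -/
theorem pow_tangent_le (m : ℕ) {a b : ℝ} (ha : 0 ≤ a) (hb : 0 ≤ b) :
    b ^ (m + 1) + (m + 1) * b ^ m * (a - b) ≤ a ^ (m + 1) := by
  induction m with
  | zero => simp
  | succ m ih =>
    have h1 := mul_le_mul_of_nonneg_left ih ha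
    have h2 : 0 ≤ (m + 1) * b ^ m * (a - b) ^ 2 := by positivity
    push_cast
    calc _ = a * (b ^ (m + 1) + (m + 1) * b ^ m * (a - b)) - (m + 1) * b ^ m * (a - b) ^ 2 := by
          ring
      _ ≤ a * a ^ (m + 1) := by linarith
      _ = _ := by ring

theorem hasSecondDerivOn_rpow (p : ℝ) {b R : ℝ} (hR : 0 < R + b) :
    HasSecondDerivOn (fun z => (z + b) ^ (-p)) (fun z => -p * (z + b) ^ (-p - 1))
      (fun z => p * (p + 1) * (z + b) ^ (-p - 2)) R := by
  intro z hz
  have hzb : z + b ≠ 0 := by linarith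
  have hd : ∀ q : ℝ, HasDerivAt (fun z => (z + b) ^ q) (q * (z + b) ^ (q - 1)) z := fun q => by
    have := ((hasDerivAt_id z).add_const b).rpow_const (p := q) (Or.inl hzb)
    exact this.congr_deriv (by simp)
  refine ⟨(hd (-p)).hasDerivWithinAt, (((hd (-p - 1)).const_mul (-p)).congr_deriv ?_).hasDerivWithinAt⟩
  rw [show -p - 1 - 1 = -p - 2 by ring]
  ring

/-! ### Existence -/

/-- There is a positive solution that decays at least like `(z + 1) ^ (-δ)`: a large multiple
of this power is a supersolution. -/
theorem exists_pos_solution {n : ℕ} (hn : 2 ≤ n) :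
    ∃ η η' : ℝ → ℝ, ∃ A : ℝ, HasSecondDerivOn η η' (fun z => source n z (η z)) 0 ∧
      η' 0 = -kappa ∧ ∀ z, 0 ≤ z → 0 < η z ∧ η z ≤ A * (z + 1) ^ (-delta n) := by
  have hκ := kappa_pos
  have hδ1 := delta_gt_one hn
  have hδ4 := delta_le_four hn
  obtain ⟨m, rfl⟩ : ∃ m, n = m + 1 := ⟨n - 1, by omega⟩
  set δ := delta (m + 1) with hδ
  set C := δ * (δ + 1) with hC
  -- `16 κ ≤ A` serves `z ≤ 1`, where `(z + 1) ^ (-δ) ≥ 2⁻⁴`; the last term gives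
  -- `A δ (δ + 1) ≤ (κ A) ^ n`.
  set A := 1 + 16 * kappa + C / kappa ^ (m + 1) with hA
  have hA0 : 0 < A := by positivity
  have hA1 : 1 ≤ A := by
    have : 0 < 16 * kappa + C / kappa ^ (m + 1) := by positivity
    linarith
  have hA16 : 16 * kappa ≤ A := by
    have : 0 < C / kappa ^ (m + 1) := by positivity
    linarith
  have hAC : A * C ≤ (kappa * A) ^ (m + 1) := by
    have h1 : C ≤ kappa ^ (m + 1) * A := by
      have h2 : kappa ^ (m + 1) * (C / kappa ^ (m + 1)) = C := by field_simp
      have h3 : 0 ≤ kappa ^ (m + 1) * (1 + 16 * kappa) := by positivity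
      rw [hA, mul_add, h2]
      linarith
    have h2 : A ≤ A ^ m := le_self_pow₀ hA1 (by omega)
    calc A * C ≤ A ^ m * (kappa ^ (m + 1) * A) := by gcongr
      _ = _ := by rw [mul_pow]; ring
  -- `D` bounds `∂f/∂u` below the supersolution.
  set D := (m + 1) * (A * (2 * kappa + A)) ^ m * (2 * kappa + 2 * A) with hD
  have hD0 : 0 < D := by positivity
  have hP : ∀ z : ℝ, 0 ≤ z → (z + 1) ^ (-δ) ≤ 1 := fun z hz =>
    Real.rpow_le_one_of_one_le_of_nonpos (by linarith) (by linarith)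
  have hP0 : ∀ z : ℝ, 0 ≤ z → 0 < (z + 1) ^ (-δ) := fun z hz => Real.rpow_pos_of_pos (by linarith) _
  have hβ := (hasSecondDerivOn_rpow δ (b := 1) (R := 0) (by norm_num)).const_mul A
  have hβ0 : ∀ z : ℝ, 0 ≤ z → 0 < A * (z + 1) ^ (-δ) := fun z hz => mul_pos hA0 (hP0 z hz)
  obtain ⟨u, u', hu, hu0, hub⟩ := exists_solution_between (f := source (m + 1)) (M := √D)
    (k := kappa) (B := A) (by unfold source Function.uncurry; fun_prop) (Real.sqrt_pos.2 hD0) hκ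
    (fun z _ => by simp [source])
    (fun z hz u v hu huv hv => by
      rw [Real.sq_sqrt hD0.le]
      have hy : 0 < z + 1 := by linarith
      have hv0 : 0 ≤ v := hu.trans huv
      have hvA : v ≤ A * (z + 1) := hv.trans
        (mul_le_mul_of_nonneg_left ((hP z hz).trans (by linarith)) hA0.le)
      have htan := pow_tangent_le m (a := 2 * kappa * z * u + u ^ 2)
        (b := 2 * kappa * z * v + v ^ 2) (by positivity) (by positivity)
      have hb : 2 * kappa * z * v + v ^ 2 ≤ A * (2 * kappa + A) * ((z + 1) * (z + 1) ^ (-δ)) := by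
        calc 2 * kappa * z * v + v ^ 2 = v * (2 * kappa * z + v) := by ring
          _ ≤ (A * (z + 1) ^ (-δ)) * (2 * kappa * (z + 1) + A * (z + 1)) := by
            gcongr; linarith
          _ = _ := by ring
      have hd : 2 * kappa * z * v + v ^ 2 - (2 * kappa * z * u + u ^ 2)
          ≤ (v - u) * ((2 * kappa + 2 * A) * (z + 1)) := by
        calc _ = (v - u) * (2 * kappa * z + (u + v)) := by ring
          _ ≤ _ := by
            gcongr
            nlinarith
      have hd0 : 0 ≤ 2 * kappa * z * v + v ^ 2 - (2 * kappa * z * u + u ^ 2) := by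
        have : 0 ≤ (v - u) * (2 * kappa * z + (u + v)) :=
          mul_nonneg (by linarith) (by positivity)
        linarith
      have key : (m + 1) * (2 * kappa * z * v + v ^ 2) ^ m *
          (2 * kappa * z * v + v ^ 2 - (2 * kappa * z * u + u ^ 2)) ≤ D * (v - u) := by
        calc _ ≤ (m + 1) * (A * (2 * kappa + A) * ((z + 1) * (z + 1) ^ (-δ))) ^ m *
              ((v - u) * ((2 * kappa + 2 * A) * (z + 1))) := by gcongr
          _ = D * (v - u) * (((z + 1) * (z + 1) ^ (-δ)) ^ m * (z + 1)) := by
            rw [mul_pow, hD]; ring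
          _ ≤ D * (v - u) * 1 := by
            rw [hδ, rpow_neg_delta_mul_pow_pred_mul (by omega) hy]
            have := Real.rpow_le_one_of_one_le_of_nonpos (x := z + 1) (z := -2) (by linarith)
              (by norm_num)
            gcongr
          _ = _ := by ring
      unfold source
      linarith)
    hβ (fun z hz => (hβ0 z hz).le)
    (fun z hz => mul_le_of_le_one_right hA0.le (hP z hz))
    (fun z hz => source_nonneg _ hz (hβ0 z hz).le)
    (fun z hz => by
      have hy : 0 < z + 1 := by linarith
      have h1 : kappa * (z + 1) ≤ 2 * kappa * z + A * (z + 1) ^ (-δ) := by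
        rcases le_total 1 z with h | h
        · have := (hβ0 z hz).le
          nlinarith
        · have h2 : (2 : ℝ) ^ (-4 : ℝ) ≤ (z + 1) ^ (-δ) :=
            calc (2 : ℝ) ^ (-4 : ℝ) ≤ 2 ^ (-δ) :=
                  Real.rpow_le_rpow_of_exponent_le (by norm_num) (by linarith)
              _ ≤ (z + 1) ^ (-δ) :=
                  Real.rpow_le_rpow_of_nonpos hy (by linarith) (by linarith)
          have h3 : (2 : ℝ) ^ (-4 : ℝ) = 1 / 16 := by
            rw [Real.rpow_neg (by norm_num)]
            norm_num
          have h4 : kappa ≤ A * (z + 1) ^ (-δ) := by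
            calc kappa = (16 * kappa) * (1 / 16) := by ring
              _ ≤ A * (z + 1) ^ (-δ) := by
                rw [h3] at h2
                gcongr
          nlinarith
      calc A * (δ * (δ + 1) * (z + 1) ^ (-δ - 2)) = A * C * (z + 1) ^ (-δ - 2) := by ring
        _ ≤ (kappa * A) ^ (m + 1) * (z + 1) ^ (-δ - 2) := by
          gcongr
        _ = (kappa * A * ((z + 1) * (z + 1) ^ (-δ))) ^ (m + 1) :=
          (rpow_neg_delta_mul_pow hn _ hy).symm
        _ ≤ source (m + 1) z (A * (z + 1) ^ (-δ)) := by
          unfold source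
          refine pow_le_pow_left₀ ?_ ?_ _
          · have := hP0 z hz
            positivity
          · have := mul_le_mul_of_nonneg_left h1 (hβ0 z hz).le
            nlinarith)
    (by
      simp only [zero_add, Real.one_rpow, mul_one]
      nlinarith)
  exact ⟨u, u', A, hu, hu0, hub⟩

/-! ### Uniqueness -/

/-- The right-hand side increases with the solution, so that the difference of two nonnegative
solutions obeys the maximum principle. -/
theorem le_of_nonneg_solutions {n : ℕ} {η η' ζ ζ' : ℝ → ℝ}
    (hη : HasSecondDerivOn η η' (fun z => source n z (η z)) 0) (hη0 : η' 0 = -kappa)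
    (hηl : Tendsto η atTop (𝓝 0)) (hηp : ∀ z, 0 ≤ z → 0 ≤ η z)
    (hζ : HasSecondDerivOn ζ ζ' (fun z => source n z (ζ z)) 0) (hζ0 : ζ' 0 = -kappa)
    (hζl : Tendsto ζ atTop (𝓝 0)) {z : ℝ} (hz : 0 ≤ z) : ζ z ≤ η z := by
  have := (hζ.sub hη).nonpos_of_neumann (hζl.sub hηl) (by simp)
    (fun y hy hpos => sub_nonneg.2 (source_mono n hy (hηp y hy) (sub_pos.1 hpos).le))
    (by simp [hη0, hζ0]) hz
  exact sub_nonpos.1 this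

/-- A convex function that tends to `0` at infinity is nonnegative. For even `n` this applies to
every solution, whatever its sign. -/
theorem nonneg_of_convex {φ φ' φ'' : ℝ → ℝ} {R : ℝ} (h : HasSecondDerivOn φ φ' φ'' R)
    (hlim : Tendsto φ atTop (𝓝 0)) (hconv : ∀ z, R ≤ z → 0 ≤ φ'' z) {a : ℝ} (ha : R ≤ a) :
    0 ≤ φ a := by
  by_contra hneg
  push Not at hneg
  obtain ⟨b, hb, hab⟩ := ((hlim.eventually (lt_mem_nhds hneg)).and (eventually_gt_atTop a)).exists
  obtain ⟨c, hc, hc'⟩ := exists_hasDerivAt_eq_slope φ φ' hab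
    (h.continuousOn.mono fun y hy => ha.trans hy.1)
    (fun y hy => h.hasDerivAt (ha.trans_lt hy.1))
  have hs : 0 < φ' c := by
    rw [hc']; exact div_pos (by linarith) (by linarith)
  have hRc : R ≤ c := ha.trans hc.1.le
  have hlin : HasSecondDerivOn (fun y => φ' c * (y - c)) (fun _ => φ' c) (fun _ => 0) c := by
    intro y _
    exact ⟨((((hasDerivAt_id y).sub_const c).const_mul (φ' c)).congr_deriv
      (by simp)).hasDerivWithinAt, (hasDerivAt_const y _).hasDerivWithinAt⟩
  have hge : ∀ y, c ≤ y → φ c + φ' c * (y - c) ≤ φ y := by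
    intro y hy
    have := ((h.mono hRc).sub hlin).le_of_convex hy
      (fun t ht => by simpa using hconv t (hRc.trans ht.1.le)) (by simp)
    simp only [sub_self, mul_zero, sub_zero] at this
    linarith
  obtain ⟨y, hy, hyc⟩ := ((hlim.eventually (gt_mem_nhds one_pos)).and
    (eventually_ge_atTop (c + (|φ c| + 1) / φ' c))).exists
  have h1 : 0 ≤ (|φ c| + 1) / φ' c := by positivity
  have h2 := hge y (by linarith)
  have h3 : φ' c * ((|φ c| + 1) / φ' c) = |φ c| + 1 := by field_simp
  have h4 := mul_le_mul_of_nonneg_left (show (|φ c| + 1) / φ' c ≤ y - c by linarith) hs.le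
  have h5 := neg_abs_le (φ c)
  linarith

end ReactionFront

/-! ### Linear comparison with powers at infinity -/

theorem rpow_sub_two {z : ℝ} (hz : 0 < z) (p : ℝ) : z ^ (p - 2) = z ^ p * z ^ (-2 : ℝ) := by
  rw [sub_eq_add_neg, Real.rpow_add hz]

theorem hasSecondDerivOn_rpow_neg (p : ℝ) {R : ℝ} (hR : 0 < R) :
    HasSecondDerivOn (fun z => z ^ (-p)) (fun z => -p * z ^ (-p - 1))
      (fun z => p * (p + 1) * z ^ (-p - 2)) R := by
  simpa using ReactionFront.hasSecondDerivOn_rpow p (b := 0) (R := R) (by simpa using hR)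

theorem tendsto_mul_rpow_neg (C : ℝ) {p : ℝ} (hp : 0 < p) :
    Tendsto (fun z : ℝ => C * z ^ (-p)) atTop (𝓝 0) := by
  simpa using (tendsto_rpow_neg_atTop hp).const_mul C

section Linear

variable {v v' v'' : ℝ → ℝ} {N K p : ℝ}

/-- For `p (p + 1) < N` a large multiple of `z ^ (-p)` is a supersolution of
`v'' = N z⁻² v - K z ^ (-p - 2)`. -/
theorem le_mul_rpow_neg_of_slow (h : HasSecondDerivOn v v' v'' 1) (hv : Tendsto v atTop (𝓝 0))
    (hp : 0 < p) (hpN : p * (p + 1) < N)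
    (hle : ∀ z, 1 ≤ z → N * z ^ (-2 : ℝ) * v z - K * z ^ (-p - 2) ≤ v'' z) {z : ℝ} (hz : 1 ≤ z) :
    v z ≤ (|v 1| + |K| / (N - p * (p + 1))) * z ^ (-p) := by
  set C := |v 1| + |K| / (N - p * (p + 1)) with hC
  have hd : 0 < N - p * (p + 1) := by linarith
  have hN : 0 < N := (by positivity : 0 < p * (p + 1)).trans hpN
  have hCK : K ≤ C * (N - p * (p + 1)) := by
    have h1 : C * (N - p * (p + 1)) = |v 1| * (N - p * (p + 1)) + |K| := by
      rw [hC]; field_simp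
    have h2 := le_abs_self K
    have h3 : 0 ≤ |v 1| * (N - p * (p + 1)) := by positivity
    linarith
  have hC1 : v 1 ≤ C := by
    have h1 := le_abs_self (v 1)
    have h2 : 0 ≤ |K| / (N - p * (p + 1)) := by positivity
    linarith
  have := (h.sub ((hasSecondDerivOn_rpow_neg p one_pos).const_mul C)).nonpos_of_dirichlet
    (hv.sub (tendsto_mul_rpow_neg C hp)) (by simp) (fun y hy hpos => ?_) (by simpa using hC1) hz
  · exact sub_nonpos.1 this
  · have hy0 : 0 < y := by linarith
    have h1 := hle y hy
    have h2 : N * y ^ (-2 : ℝ) * (C * y ^ (-p)) ≤ N * y ^ (-2 : ℝ) * v y :=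
      mul_le_mul_of_nonneg_left (sub_pos.1 hpos).le (by positivity)
    have h3 := mul_le_mul_of_nonneg_right hCK (Real.rpow_pos_of_pos hy0 (-p - 2)).le
    rw [rpow_sub_two hy0] at h1 h3 ⊢
    linarith

/-- Forcing of order `z ^ (-p - 2)` with `p` below the free decay exponent leads to a solution of
order `z ^ (-p)`. -/
theorem abs_le_mul_rpow_neg_of_slow (h : HasSecondDerivOn v v' v'' 1) (hv : Tendsto v atTop (𝓝 0))
    (hp : 0 < p) (hpN : p * (p + 1) < N)
    (hle : ∀ z, 1 ≤ z → |v'' z - N * z ^ (-2 : ℝ) * v z| ≤ K * z ^ (-p - 2)) :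
    ∃ C, ∀ z, 1 ≤ z → |v z| ≤ C * z ^ (-p) := by
  refine ⟨|v 1| + |K| / (N - p * (p + 1)), fun z hz => abs_le.2 ⟨?_, ?_⟩⟩
  · have := le_mul_rpow_neg_of_slow (K := K) h.neg (by simpa using hv.neg) hp hpN
      (fun y hy => by have := (abs_le.1 (hle y hy)).2; linarith) hz
    rw [abs_neg] at this
    linarith
  · exact le_mul_rpow_neg_of_slow h hv hp hpN
      (fun y hy => by have := (abs_le.1 (hle y hy)).1; linarith) hz

variable {μ : ℝ}

/-- For `p > μ` the function `a z ^ (-μ) - C z ^ (-p)` is a supersolution of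
`v'' = μ (μ + 1) z⁻² v - K z ^ (-p - 2)`. Choosing `a` to match `v` at `R` bounds how much
`z ^ μ * v z` can increase after `R`. -/
theorem rpow_mul_le_of_fast (h : HasSecondDerivOn v v' v'' 1) (hv : Tendsto v atTop (𝓝 0))
    (hμ : 0 < μ) (hp : μ < p)
    (hle : ∀ z, 1 ≤ z → μ * (μ + 1) * z ^ (-2 : ℝ) * v z - K * z ^ (-p - 2) ≤ v'' z)
    (hK : 0 ≤ K) {R z : ℝ} (hR : 1 ≤ R) (hz : R ≤ z) :
    z ^ μ * v z ≤ R ^ μ * v R + K / (p * (p + 1) - μ * (μ + 1)) * R ^ (μ - p) := by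
  have hR0 : 0 < R := by linarith
  have hz0 : 0 < z := by linarith
  have hd : 0 < p * (p + 1) - μ * (μ + 1) := by nlinarith
  set C := K / (p * (p + 1) - μ * (μ + 1)) with hC
  have hCK : K = C * (p * (p + 1) - μ * (μ + 1)) := by rw [hC]; field_simp
  set a := R ^ μ * v R + C * R ^ (μ - p) with ha
  have hbar := ((hasSecondDerivOn_rpow_neg μ hR0).const_mul a).sub
    ((hasSecondDerivOn_rpow_neg p hR0).const_mul C)
  have haR : a * R ^ (-μ) - C * R ^ (-p) = v R := by
    have e1 : R ^ μ * R ^ (-μ) = 1 := by rw [← Real.rpow_add hR0]; simp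
    have e2 : R ^ (μ - p) * R ^ (-μ) = R ^ (-p) := by rw [← Real.rpow_add hR0]; congr 1; ring
    rw [ha]
    linear_combination v R * e1 + C * e2
  have := ((h.mono hR).sub hbar).nonpos_of_dirichlet
    (hv.sub ((tendsto_mul_rpow_neg a hμ).sub (tendsto_mul_rpow_neg C (hμ.trans hp)))) (by simp)
    (fun y hy hpos => ?_) (by linarith) hz
  · have h1 : v z ≤ a * z ^ (-μ) := by
      have : 0 ≤ C * z ^ (-p) := by positivity
      linarith
    calc z ^ μ * v z ≤ z ^ μ * (a * z ^ (-μ)) := by gcongr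
      _ = a * (z ^ μ * z ^ (-μ)) := by ring
      _ = a := by rw [← Real.rpow_add hz0]; simp
  · have hy0 : 0 < y := by linarith
    have h1 := hle y (hR.trans hy)
    have h2 : μ * (μ + 1) * y ^ (-2 : ℝ) * (a * y ^ (-μ) - C * y ^ (-p))
        ≤ μ * (μ + 1) * y ^ (-2 : ℝ) * v y :=
      mul_le_mul_of_nonneg_left (sub_pos.1 hpos).le (by positivity)
    rw [rpow_sub_two hy0] at h1
    rw [rpow_sub_two hy0, rpow_sub_two hy0]
    have h3 : K * (y ^ (-p) * y ^ (-2 : ℝ))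
        = C * (p * (p + 1) - μ * (μ + 1)) * (y ^ (-p) * y ^ (-2 : ℝ)) := by rw [← hCK]
    linarith

/-- A perturbation of `v'' = μ (μ + 1) z⁻² v` that decays faster than `z ^ (-μ - 2)` leaves a
well-defined leading coefficient of `z ^ (-μ)`. -/
theorem exists_tendsto_rpow_mul (h : HasSecondDerivOn v v' v'' 1) (hv : Tendsto v atTop (𝓝 0))
    (hμ : 0 < μ) (hp : μ < p)
    (hle : ∀ z, 1 ≤ z → |v'' z - μ * (μ + 1) * z ^ (-2 : ℝ) * v z| ≤ K * z ^ (-p - 2)) :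
    ∃ L, Tendsto (fun z => z ^ μ * v z) atTop (𝓝 L) := by
  have hK : 0 ≤ K := by simpa using (abs_nonneg _).trans (hle 1 le_rfl)
  set C := K / (p * (p + 1) - μ * (μ + 1)) with hC
  have hbound : ∀ R z, 1 ≤ R → R ≤ z → |z ^ μ * v z - R ^ μ * v R| ≤ C * R ^ (-(p - μ)) := by
    intro R z hR hz
    have h1 := rpow_mul_le_of_fast h hv hμ hp
      (fun y hy => by have := (abs_le.1 (hle y hy)).1; linarith) hK hR hz
    have h2 := rpow_mul_le_of_fast h.neg (by simpa using hv.neg) hμ hp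
      (fun y hy => by have := (abs_le.1 (hle y hy)).2; linarith) hK hR hz
    rw [neg_sub, abs_le]
    constructor <;> linarith
  refine cauchySeq_tendsto_of_complete (Metric.cauchySeq_iff'.2 fun ε hε => ?_)
  obtain ⟨R, hR, hR1⟩ := (((tendsto_mul_rpow_neg C (sub_pos.2 hp)).eventually
    (gt_mem_nhds hε)).and (eventually_ge_atTop 1)).exists
  exact ⟨R, fun z hz => (hbound R z hR1 hz).trans_lt hR⟩

end Linear

namespace ReactionFront

/-! ### The linearised equation at infinity -/

/-- The decay exponent of the linearisation `v'' = nδ(δ+1) z⁻² v` at the leading term. -/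
noncomputable def mu (n : ℕ) : ℝ := (Real.sqrt (4 * n * delta n * (delta n + 1) + 1) - 1) / 2

section Exponents

variable {n : ℕ}

theorem mu_mul_add_one (hn : 2 ≤ n) : mu n * (mu n + 1) = n * delta n * (delta n + 1) := by
  have h1 := delta_gt_one hn
  have h2 : 0 ≤ 4 * n * delta n * (delta n + 1) + 1 := by positivity
  have := Real.mul_self_sqrt h2
  unfold mu
  linear_combination this / 4

theorem mu_pos (hn : 2 ≤ n) : 0 < mu n := by
  have h1 := delta_gt_one hn
  have h2 : 0 < 4 * n * delta n * (delta n + 1) := by positivity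
  have : 1 < Real.sqrt (4 * n * delta n * (delta n + 1) + 1) :=
    Real.lt_sqrt_of_sq_lt (by linarith)
  unfold mu
  linarith

theorem lt_mu_iff (hn : 2 ≤ n) {p : ℝ} (hp : 0 ≤ p) :
    p < mu n ↔ p * (p + 1) < n * delta n * (delta n + 1) := by
  rw [← mu_mul_add_one hn]
  have := mu_pos hn
  constructor <;> intro h <;> nlinarith

theorem mu_lt_iff (hn : 2 ≤ n) {p : ℝ} (hp : 0 ≤ p) :
    mu n < p ↔ n * delta n * (delta n + 1) < p * (p + 1) := by
  rw [← mu_mul_add_one hn]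
  have := mu_pos hn
  constructor <;> intro h <;> nlinarith

theorem delta_add_one_lt_mu (hn : 2 ≤ n) : delta n + 1 < mu n := by
  have h1 := delta_gt_one hn
  have h2 := delta_add_two hn
  rw [lt_mu_iff hn (by linarith)]
  nlinarith

theorem mu_lt_of_le_five (hn : 2 ≤ n) (h5 : n ≤ 5) : mu n < 2 * delta n + 1 := by
  have h1 := delta_gt_one hn
  rw [mu_lt_iff hn (by linarith)]
  have : (n : ℝ) * delta n < 2 * (2 * delta n + 1) := by
    interval_cases n <;> norm_num [delta]
  nlinarith

theorem lt_mu_of_six_le (h6 : 6 ≤ n) : 2 * delta n + 1 < mu n := by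
  have hn : 2 ≤ n := by omega
  have h1 := delta_gt_one hn
  have h2 := delta_add_two hn
  have h0 : (6 : ℝ) ≤ n := by exact_mod_cast h6
  rw [lt_mu_iff hn (by linarith)]
  have : 2 * (2 * delta n + 1) < (n : ℝ) * delta n := by
    have h3 : delta n < 2 := by
      rw [delta, div_lt_iff₀ (by linarith)]
      linarith
    linarith
  nlinarith

theorem delta_lt_delta' (hn : 2 ≤ n) : delta n < delta' n := by
  unfold delta'
  split_ifs
  · have := delta_add_one_lt_mu hn
    unfold mu at this
    linarith
  · have := delta_gt_one hn
    linarith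

theorem lam_pos (hn : 2 ≤ n) : 0 < lam n := by
  have h1 := delta_gt_one hn
  have h2 := kappa_pos
  unfold lam
  positivity

theorem lam_pow_pred {m : ℕ} (hm : 1 ≤ m) :
    (2 * kappa) ^ (m + 1) * lam (m + 1) ^ m = delta (m + 1) * (delta (m + 1) + 1) := by
  have h1 := delta_gt_one (n := m + 1) (by omega)
  have h2 := kappa_pos
  have h3 : (m : ℝ) ≠ 0 := by exact_mod_cast (by omega : m ≠ 0)
  have h4 : lam (m + 1) ^ m
      = delta (m + 1) * (delta (m + 1) + 1) / (2 * kappa) ^ (m + 1) := by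
    unfold lam
    rw [← Real.rpow_mul_natCast (by positivity)]
    have : 1 / (((m + 1 : ℕ) : ℝ) - 1) * m = 1 := by
      push_cast
      rw [add_sub_cancel_right, one_div_mul_cancel h3]
    rw [this, Real.rpow_one]
  rw [h4]
  field_simp

/-- The power `λ z ^ (-δ)` solves `u'' = (2κzu)^n`. -/
theorem leading_pow (hn : 2 ≤ n) {y : ℝ} (hy : 0 < y) :
    (2 * kappa * lam n * (y * y ^ (-delta n))) ^ n
      = delta n * (delta n + 1) * lam n * y ^ (-delta n - 2) := by
  obtain ⟨m, rfl⟩ : ∃ m, n = m + 1 := ⟨n - 1, by omega⟩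
  rw [rpow_neg_delta_mul_pow hn _ hy, mul_pow, pow_succ (lam (m + 1)),
    ← lam_pow_pred (by omega : 1 ≤ m)]
  ring

end Exponents

/-! ### Two-sided bounds at infinity -/

section Bounds

variable {n : ℕ} {η η' : ℝ → ℝ}

/-- By convexity of `x ↦ x ^ n`, the sum of `λ z ^ (-δ)` and a decaying solution of the linearised
equation is a supersolution. -/
theorem solution_le (hn : 2 ≤ n) (hη : HasSecondDerivOn η η' (fun z => source n z (η z)) 0)
    (hlim : Tendsto η atTop (𝓝 0)) (hpos : ∀ z, 0 ≤ z → 0 < η z) {z : ℝ} (hz : 1 ≤ z) :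
    η z ≤ lam n * z ^ (-delta n) + η 1 * z ^ (-mu n) := by
  have hκ := kappa_pos
  have hl := lam_pos hn
  have hδ := delta_gt_one hn
  have hμ := mu_pos hn
  have h1 := hpos 1 zero_le_one
  have hbar := ((hasSecondDerivOn_rpow_neg (delta n) one_pos).const_mul (lam n)).add
    ((hasSecondDerivOn_rpow_neg (mu n) one_pos).const_mul (η 1))
  have hblim : Tendsto (fun z : ℝ => lam n * z ^ (-delta n) + η 1 * z ^ (-mu n)) atTop (𝓝 0) := by
    simpa using (tendsto_mul_rpow_neg (lam n) (by linarith : 0 < delta n)).add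
      (tendsto_mul_rpow_neg (η 1) hμ)
  have := ((hη.mono zero_le_one).sub hbar).nonpos_of_dirichlet (hlim.sub hblim) (by simp)
    (fun y hy hφ => ?_) (by simpa using hl.le) hz
  · exact sub_nonpos.1 this
  · have hy0 : 0 < y := by linarith
    rw [sub_nonneg]
    obtain ⟨m, rfl⟩ : ∃ m, n = m + 1 := ⟨n - 1, by omega⟩
    set δ := delta (m + 1)
    set l := lam (m + 1)
    set μ := mu (m + 1) with hμ'
    have hb : 0 < l * y ^ (-δ) + η 1 * y ^ (-μ) := by positivity
    have htan := pow_tangent_le m (a := 2 * kappa * y * (l * y ^ (-δ) + η 1 * y ^ (-μ)))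
      (b := 2 * kappa * l * (y * y ^ (-δ))) (by positivity) (by positivity)
    have hlin : (2 * kappa * l * (y * y ^ (-δ))) ^ m * (2 * kappa * y)
        = δ * (δ + 1) * y ^ (-2 : ℝ) := by
      rw [← rpow_neg_delta_mul_pow_pred_mul (by omega : 1 ≤ m) hy0,
        ← lam_pow_pred (by omega : 1 ≤ m), mul_pow]
      ring
    calc l * (δ * (δ + 1) * y ^ (-δ - 2)) + η 1 * (μ * (μ + 1) * y ^ (-μ - 2))
        = δ * (δ + 1) * l * y ^ (-δ - 2)
          + (m + 1) * (δ * (δ + 1) * y ^ (-2 : ℝ)) * (η 1 * y ^ (-μ)) := by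
          rw [mu_mul_add_one hn, rpow_sub_two hy0 (-μ)]
          push_cast
          ring
      _ = (2 * kappa * l * (y * y ^ (-δ))) ^ (m + 1) + (m + 1) *
          (2 * kappa * l * (y * y ^ (-δ))) ^ m *
          (2 * kappa * y * (l * y ^ (-δ) + η 1 * y ^ (-μ)) - 2 * kappa * l * (y * y ^ (-δ))) := by
          rw [leading_pow hn hy0, ← hlin]
          ring
      _ ≤ (2 * kappa * y * (l * y ^ (-δ) + η 1 * y ^ (-μ))) ^ (m + 1) := htan
      _ ≤ source (m + 1) y (l * y ^ (-δ) + η 1 * y ^ (-μ)) := by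
          unfold source
          gcongr
          nlinarith
      _ ≤ source (m + 1) y (η y) := source_mono _ hy0.le hb.le (sub_pos.1 hφ).le

/-- Shifted copies `λ (z + b) ^ (-δ)` of the leading term are subsolutions for large `b`. -/
theorem exists_shift_le_solution (hn : 2 ≤ n)
    (hη : HasSecondDerivOn η η' (fun z => source n z (η z)) 0) (hη0 : η' 0 = -kappa)
    (hlim : Tendsto η atTop (𝓝 0)) (hpos : ∀ z, 0 ≤ z → 0 < η z) :
    ∃ b : ℝ, 0 < b ∧ ∀ z, 0 ≤ z → lam n * (z + b) ^ (-delta n) ≤ η z := by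
  have hκ := kappa_pos
  have hl := lam_pos hn
  have hδ := delta_gt_one hn
  -- The last two terms give `λ ≤ 2κb`, for the differential inequality, and `δλ ≤ κb`, for the
  -- slope at `0`.
  set b := 1 + lam n / (2 * kappa) + delta n * lam n / kappa with hb
  have hb1 : 1 ≤ b := by
    have : 0 < lam n / (2 * kappa) + delta n * lam n / kappa := by positivity
    linarith
  have hbl : lam n ≤ 2 * kappa * b := by
    have h1 : 2 * kappa * (lam n / (2 * kappa)) = lam n := by field_simp
    have h2 : 0 < 2 * kappa * (1 + delta n * lam n / kappa) := by positivity
    rw [hb]; linarith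
  have hbs : delta n * lam n ≤ kappa * b := by
    have h1 : kappa * (delta n * lam n / kappa) = delta n * lam n := by field_simp
    have h2 : 0 < kappa * (1 + lam n / (2 * kappa)) := by positivity
    rw [hb]; linarith
  refine ⟨b, by linarith, fun z hz => ?_⟩
  have hbar := (hasSecondDerivOn_rpow (delta n) (b := b) (R := 0) (by linarith)).const_mul (lam n)
  have hblim : Tendsto (fun z : ℝ => lam n * (z + b) ^ (-delta n)) atTop (𝓝 0) :=
    (tendsto_mul_rpow_neg (lam n) (by linarith : 0 < delta n)).comp
      (tendsto_atTop_add_const_right _ b tendsto_id)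
  refine sub_nonpos.1 ((hbar.sub hη).nonpos_of_neumann (hblim.sub hlim) (by simp)
    (fun y hy hφ => ?_) ?_ hz)
  · have hyb : 0 < y + b := by linarith
    have hα : 0 < lam n * (y + b) ^ (-delta n) := by positivity
    rw [sub_nonneg]
    calc source n y (η y) ≤ source n y (lam n * (y + b) ^ (-delta n)) :=
          source_mono n hy (hpos y hy).le (sub_pos.1 hφ).le
      _ ≤ (2 * kappa * lam n * ((y + b) * (y + b) ^ (-delta n))) ^ n := by
          unfold source
          refine pow_le_pow_left₀ (by positivity) ?_ _
          have h1 : (y + b) ^ (-delta n) ≤ 1 :=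
            Real.rpow_le_one_of_one_le_of_nonpos (by linarith) (by linarith)
          have h2 : lam n * (y + b) ^ (-delta n) ≤ 2 * kappa * b :=
            (mul_le_of_le_one_right hl.le h1).trans hbl
          have h3 := mul_le_mul_of_nonneg_left h2 hα.le
          linarith
      _ = lam n * (delta n * (delta n + 1) * (y + b) ^ (-delta n - 2)) := by
          rw [leading_pow hn hyb]; ring
  · have h1 : b ^ (-delta n - 1) ≤ b ^ (-1 : ℝ) :=
      Real.rpow_le_rpow_of_exponent_le hb1 (by linarith)
    rw [Real.rpow_neg_one] at h1
    have h2 := mul_le_mul_of_nonneg_left h1 (by positivity : 0 ≤ delta n * lam n)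
    have h3 : delta n * lam n * b⁻¹ ≤ kappa := by
      rw [← div_eq_mul_inv, div_le_iff₀ (by linarith)]
      exact hbs
    rw [hη0]
    simp only [zero_add]
    linarith

theorem one_sub_le_one_add_rpow_neg {x p : ℝ} (hx : 0 ≤ x) (hp : 0 ≤ p) :
    1 - p * x ≤ (1 + x) ^ (-p) := by
  rw [Real.rpow_def_of_pos (by linarith)]
  have h1 := Real.log_le_sub_one_of_pos (by linarith : 0 < 1 + x)
  have h2 := Real.add_one_le_exp (Real.log (1 + x) * -p)
  nlinarith

theorem exists_abs_sub_leading_le (hn : 2 ≤ n)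
    (hη : HasSecondDerivOn η η' (fun z => source n z (η z)) 0) (hη0 : η' 0 = -kappa)
    (hlim : Tendsto η atTop (𝓝 0)) (hpos : ∀ z, 0 ≤ z → 0 < η z) :
    ∃ C, ∀ z, 1 ≤ z → |η z - lam n * z ^ (-delta n)| ≤ C * z ^ (-(delta n + 1)) := by
  have hl := lam_pos hn
  have hδ := delta_gt_one hn
  have hμ := delta_add_one_lt_mu hn
  have h1 := hpos 1 zero_le_one
  obtain ⟨b, hb, hlow⟩ := exists_shift_le_solution hn hη hη0 hlim hpos
  refine ⟨η 1 + lam n * delta n * b, fun z hz => ?_⟩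
  have hz0 : 0 < z := by linarith
  have hup := solution_le hn hη hlim hpos hz
  have hzμ : z ^ (-mu n) ≤ z ^ (-(delta n + 1)) :=
    Real.rpow_le_rpow_of_exponent_le hz (by linarith)
  have hlo := hlow z hz0.le
  have hzb : (z + b) ^ (-delta n) = z ^ (-delta n) * (1 + b / z) ^ (-delta n) := by
    rw [← Real.mul_rpow hz0.le (by positivity)]
    congr 1
    field_simp
  have hz1 : z ^ (-(delta n + 1)) = z ^ (-delta n) * z⁻¹ := by
    rw [← Real.rpow_neg_one z, ← Real.rpow_add hz0]; congr 1; ring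
  have hber := mul_le_mul_of_nonneg_left (one_sub_le_one_add_rpow_neg (x := b / z) (p := delta n)
    (by positivity) (by linarith)) (by positivity : 0 ≤ lam n * z ^ (-delta n))
  have hq : 0 < z ^ (-(delta n + 1)) := by positivity
  have e1 := mul_le_mul_of_nonneg_left hzμ h1.le
  have e2 : 0 < lam n * delta n * b * z ^ (-(delta n + 1)) := by positivity
  have e3 : 0 < η 1 * z ^ (-(delta n + 1)) := by positivity
  have e4 : lam n * z ^ (-delta n) * (1 - delta n * (b / z))
      = lam n * z ^ (-delta n) - lam n * delta n * b * z ^ (-(delta n + 1)) := by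
    rw [hz1]; ring
  rw [hzb] at hlo
  rw [abs_le]
  constructor <;> linarith

end Bounds

/-! ### The two-term expansion at infinity -/

/-- Second-order Taylor estimate for `(1 + X) ^ n`, uniform on bounded sets. -/
theorem exists_one_add_pow_sub_le (n : ℕ) {c : ℝ} (hc : 0 ≤ c) :
    ∃ K, 0 ≤ K ∧ ∀ X : ℝ, |X| ≤ c → |(1 + X) ^ n - 1 - n * X| ≤ K * X ^ 2 := by
  induction n with
  | zero => exact ⟨0, le_rfl, fun X _ => by simp⟩
  | succ n ih =>
    obtain ⟨K, hK, h⟩ := ih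
    refine ⟨(1 + c) * K + n, by positivity, fun X hX => ?_⟩
    have h1 : |1 + X| ≤ 1 + c := (abs_add_le 1 X).trans (by simpa using hX)
    have e : (1 + X) ^ (n + 1) - 1 - ((n + 1 : ℕ) : ℝ) * X
        = (1 + X) * ((1 + X) ^ n - 1 - n * X) + n * X ^ 2 := by push_cast; ring
    rw [e]
    calc _ ≤ |1 + X| * |(1 + X) ^ n - 1 - n * X| + |n * X ^ 2| := by
          rw [← abs_mul]; exact abs_add_le _ _
      _ ≤ (1 + c) * (K * X ^ 2) + n * X ^ 2 := by
          rw [abs_of_nonneg (by positivity : 0 ≤ (n : ℝ) * X ^ 2)]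
          have := h X hX
          gcongr
      _ = _ := by ring

section

variable {n : ℕ} {η η' : ℝ → ℝ}

/-- If `η = λ z ^ (-δ) + v` with `v = O(z ^ (-δ - e))`, then the right-hand side is its
linearisation at `λ z ^ (-δ)`, plus the explicit contribution of `u²`, up to an error quadratic in
the relative deviation `z ^ (-e)`. -/
theorem exists_remainder_le (hn : 2 ≤ n) {C e : ℝ} (he0 : 0 ≤ e) (he : e ≤ delta n + 1)
    (hv : ∀ z, 1 ≤ z → |η z - lam n * z ^ (-delta n)| ≤ C * z ^ (-(delta n + e))) :
    ∃ K, ∀ z, 1 ≤ z → |source n z (η z) - lam n * (delta n * (delta n + 1) * z ^ (-delta n - 2))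
      - n * delta n * (delta n + 1) * z ^ (-2 : ℝ) * (η z - lam n * z ^ (-delta n))
      - n * delta n * (delta n + 1) * lam n ^ 2 / (2 * kappa) * z ^ (-(2 * delta n + 1) - 2)|
      ≤ K * z ^ (-(delta n + 2 * e) - 2) := by
  have hκ := kappa_pos
  have hl := lam_pos hn
  have hδ := delta_gt_one hn
  set δ := delta n
  set l := lam n
  have hC : 0 ≤ C := by simpa using (abs_nonneg _).trans (hv 1 le_rfl)
  set c₁ := C / l with hc₁
  set c₂ := l / (2 * kappa) with hc₂
  have hc₁0 : 0 ≤ c₁ := by positivity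
  have hc₂0 : 0 ≤ c₂ := by positivity
  set c₃ := c₁ + c₂ * (1 + c₁) ^ 2 with hc₃
  have hc₃0 : 0 ≤ c₃ := by positivity
  obtain ⟨K, hK, hT⟩ := exists_one_add_pow_sub_le n hc₃0
  refine ⟨δ * (δ + 1) * l * (n * (c₂ * (2 * c₁ + c₁ ^ 2)) + K * c₃ ^ 2), fun z hz => ?_⟩
  have hz0 : 0 < z := by linarith
  set P := z ^ (-δ) with hP
  have hP0 : 0 < P := by positivity
  set w := z ^ (-e) with hw
  have hw1 : w ≤ 1 := Real.rpow_le_one_of_one_le_of_nonpos hz (by linarith)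
  -- `x` is the deviation of `η` relative to the leading term, `y` the relative size of `u²`.
  set x := (η z - l * P) / (l * P) with hx
  set y := c₂ * (P * z⁻¹) with hy
  have hvx : η z - l * P = l * P * x := by rw [hx]; field_simp
  have hηx : η z = l * P * (1 + x) := by linear_combination hvx
  have hy0 : 0 ≤ y := by positivity
  have hPz : P * z⁻¹ = z ^ (-(δ + 1)) := by
    rw [← Real.rpow_neg_one z, ← Real.rpow_add hz0]; congr 1; ring
  have hyw : y ≤ c₂ * w := by
    rw [hy, hPz]
    exact mul_le_mul_of_nonneg_left
      (Real.rpow_le_rpow_of_exponent_le hz (by linarith)) hc₂0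
  have hxw : |x| ≤ c₁ * w := by
    have h1 := hv z hz
    have h2 : z ^ (-(δ + e)) = P * w := by rw [← Real.rpow_add hz0]; congr 1; ring
    rw [hx, abs_div, abs_of_pos (by positivity : 0 < l * P), div_le_iff₀ (by positivity)]
    rw [h2] at h1
    calc _ ≤ C * (P * w) := h1
      _ = c₁ * w * (l * P) := by rw [hc₁]; field_simp
  have hx1 : |x| ≤ c₁ := hxw.trans (mul_le_of_le_one_right hc₁0 hw1)
  set X := x + y * (1 + x) ^ 2 with hX
  have hXw : |X| ≤ c₃ * w := by
    have h1 : |1 + x| ≤ 1 + c₁ := (abs_add_le 1 x).trans (by simpa using hx1)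
    have h2 : (1 + x) ^ 2 ≤ (1 + c₁) ^ 2 := by
      rw [← sq_abs (1 + x)]; gcongr
    calc |X| ≤ |x| + |y * (1 + x) ^ 2| := abs_add_le _ _
      _ = |x| + y * (1 + x) ^ 2 := by rw [abs_of_nonneg (by positivity : 0 ≤ y * (1 + x) ^ 2)]
      _ ≤ c₁ * w + c₂ * w * (1 + c₁) ^ 2 := by gcongr
      _ = c₃ * w := by rw [hc₃]; ring
  have hX1 : |X| ≤ c₃ := hXw.trans (mul_le_of_le_one_right hc₃0 hw1)
  have hsrc : source n z (η z) = δ * (δ + 1) * l * z ^ (-δ - 2) * (1 + X) ^ n := by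
    have hlead : (2 * kappa * l * (z * P)) ^ n = δ * (δ + 1) * l * z ^ (-δ - 2) :=
      leading_pow hn hz0
    rw [← hlead, ← mul_pow, source, hηx, hX, hy, hc₂]
    congr 1
    field_simp
    ring
  have hlin : (n : ℝ) * δ * (δ + 1) * z ^ (-2 : ℝ) * (η z - l * P)
      = δ * (δ + 1) * l * z ^ (-δ - 2) * (n * x) := by
    rw [hvx, rpow_sub_two hz0]; ring
  have hquad : (n : ℝ) * δ * (δ + 1) * l ^ 2 / (2 * kappa) * z ^ (-(2 * δ + 1) - 2)
      = δ * (δ + 1) * l * z ^ (-δ - 2) * (n * y) := by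
    have h1 : z ^ (-(2 * δ + 1) - 2) = z ^ (-δ - 2) * (P * z⁻¹) := by
      rw [hPz, ← Real.rpow_add hz0]; congr 1; ring
    rw [h1, hy, hc₂]; ring
  have hE : |(1 + X) ^ n - 1 - n * X| ≤ K * c₃ ^ 2 * w ^ 2 := by
    calc _ ≤ K * X ^ 2 := hT X hX1
      _ = K * |X| ^ 2 := by rw [sq_abs]
      _ ≤ K * (c₃ * w) ^ 2 := by gcongr
      _ = _ := by ring
  have hcross : |n * (y * (2 * x + x ^ 2))| ≤ n * (c₂ * (2 * c₁ + c₁ ^ 2)) * w ^ 2 := by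
    have h1 : |2 * x + x ^ 2| ≤ (2 * c₁ + c₁ ^ 2) * w := by
      calc _ ≤ |2 * x| + |x ^ 2| := abs_add_le _ _
        _ = 2 * |x| + |x| * |x| := by rw [abs_mul, abs_pow, abs_two]; ring
        _ ≤ 2 * (c₁ * w) + c₁ * (c₁ * w) := by gcongr
        _ = _ := by ring
    rw [abs_mul, abs_mul, Nat.abs_cast, abs_of_nonneg hy0]
    calc _ ≤ (n : ℝ) * (c₂ * w * ((2 * c₁ + c₁ ^ 2) * w)) := by gcongr
      _ = _ := by ring
  have hw2 : z ^ (-(δ + 2 * e) - 2) = z ^ (-δ - 2) * w ^ 2 := by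
    rw [hw, ← Real.rpow_mul_natCast hz0.le, ← Real.rpow_add hz0]
    congr 1; push_cast; ring
  rw [hsrc, hlin, hquad, hw2]
  have e1 : δ * (δ + 1) * l * z ^ (-δ - 2) * (1 + X) ^ n - l * (δ * (δ + 1) * z ^ (-δ - 2))
      - δ * (δ + 1) * l * z ^ (-δ - 2) * (n * x) - δ * (δ + 1) * l * z ^ (-δ - 2) * (n * y)
      = δ * (δ + 1) * l * z ^ (-δ - 2) *
        (n * (y * (2 * x + x ^ 2)) + ((1 + X) ^ n - 1 - n * X)) := by
    rw [hX]; ring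
  rw [e1, abs_mul, abs_of_pos (by positivity : 0 < δ * (δ + 1) * l * z ^ (-δ - 2))]
  calc _ ≤ δ * (δ + 1) * l * z ^ (-δ - 2) *
        (n * (c₂ * (2 * c₁ + c₁ ^ 2)) * w ^ 2 + K * c₃ ^ 2 * w ^ 2) := by
        gcongr
        exact (abs_add_le _ _).trans (add_le_add hcross hE)
    _ = _ := by ring

theorem hasSecondDerivOn_deviation (hη : HasSecondDerivOn η η' (fun z => source n z (η z)) 0) :
    HasSecondDerivOn (fun z => η z - lam n * z ^ (-delta n))
      (fun z => η' z - lam n * (-delta n * z ^ (-delta n - 1)))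
      (fun z => source n z (η z) - lam n * (delta n * (delta n + 1) * z ^ (-delta n - 2))) 1 :=
  (hη.mono zero_le_one).sub ((hasSecondDerivOn_rpow_neg (delta n) one_pos).const_mul (lam n))

/-- The two-term expansion. The crude bound `v = O(z ^ (-δ - 1))` is improved once by comparison,
after which the quadratic error in the equation for `v` is negligible at order `δ'`. Then either
the free term `z ^ (-μ)` dominates (`n ≤ 5`), or the particular solution driven by `u²`, of order
`z ^ (-2δ - 1)`, does (`n ≥ 6`). -/
theorem exists_expansion_atTop (hn : 2 ≤ n)
    (hη : HasSecondDerivOn η η' (fun z => source n z (η z)) 0) (hη0 : η' 0 = -kappa)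
    (hlim : Tendsto η atTop (𝓝 0)) (hpos : ∀ z, 0 ≤ z → 0 < η z) :
    ∃ L, Tendsto (fun z => z ^ delta' n *
      |η z - (lam n * z ^ (-delta n) + L * z ^ (-delta' n))|) atTop (𝓝 0) := by
  have hκ := kappa_pos
  have hδ := delta_gt_one hn
  have hμδ := delta_add_one_lt_mu hn
  have hμ0 := mu_pos hn
  have hdev := hasSecondDerivOn_deviation hη
  have hvlim : Tendsto (fun z => η z - lam n * z ^ (-delta n)) atTop (𝓝 0) := by
    simpa using hlim.sub (tendsto_mul_rpow_neg (lam n) (by linarith : 0 < delta n))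
  set B := n * delta n * (delta n + 1) * lam n ^ 2 / (2 * kappa) with hB
  have hB0 : 0 ≤ B := by positivity
  -- The forcing term is of order `z ^ (-p - 2)` for all `p` up to `δ + 2e` and `2δ + 1`.
  have hforce : ∀ C e p : ℝ, 0 ≤ e → e ≤ delta n + 1 → p ≤ delta n + 2 * e → p ≤ 2 * delta n + 1 →
      (∀ z, 1 ≤ z → |η z - lam n * z ^ (-delta n)| ≤ C * z ^ (-(delta n + e))) →
      ∃ K, ∀ z, 1 ≤ z →
        |source n z (η z) - lam n * (delta n * (delta n + 1) * z ^ (-delta n - 2))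
        - mu n * (mu n + 1) * z ^ (-2 : ℝ) * (η z - lam n * z ^ (-delta n))|
        ≤ K * z ^ (-p - 2) := by
    intro C e p he0 he hp1 hp2 hv
    obtain ⟨K, hK⟩ := exists_remainder_le hn he0 he hv
    have hK0 : 0 ≤ K := by simpa using (abs_nonneg _).trans (hK 1 le_rfl)
    refine ⟨K + B, fun z hz => ?_⟩
    have h1 := abs_le.1 (hK z hz)
    have h2 : K * z ^ (-(delta n + 2 * e) - 2) ≤ K * z ^ (-p - 2) :=
      mul_le_mul_of_nonneg_left (Real.rpow_le_rpow_of_exponent_le hz (by linarith)) hK0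
    have h3 : B * z ^ (-(2 * delta n + 1) - 2) ≤ B * z ^ (-p - 2) :=
      mul_le_mul_of_nonneg_left (Real.rpow_le_rpow_of_exponent_le hz (by linarith)) hB0
    have h4 : 0 ≤ B * z ^ (-(2 * delta n + 1) - 2) := by
      positivity
    rw [mu_mul_add_one hn, abs_le]
    constructor <;> linarith [h1.1, h1.2]
  obtain ⟨C₁, hC₁⟩ := exists_abs_sub_leading_le hn hη hη0 hlim hpos
  -- `p₁ = δ + e` is the improved order of `v`; `2e > δ' - δ` because `δ' ≤ μ` and `δ' ≤ 2δ + 1`.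
  set p₁ := min (delta n + 2) ((mu n + delta n + 1) / 2) with hp₁
  have hp₁a : p₁ ≤ delta n + 2 := min_le_left _ _
  have hp₁b : p₁ ≤ (mu n + delta n + 1) / 2 := min_le_right _ _
  have hp₁δ : delta n + 1 < p₁ := lt_min (by linarith) (by linarith)
  obtain ⟨K₁, hK₁⟩ := hforce C₁ 1 p₁ zero_le_one (by linarith) (by linarith) (by linarith) hC₁
  obtain ⟨C₂, hC₂⟩ := abs_le_mul_rpow_neg_of_slow hdev hvlim (by linarith)
    (by nlinarith : p₁ * (p₁ + 1) < mu n * (mu n + 1)) hK₁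
  set e := p₁ - delta n with he
  have hC₂' : ∀ z, 1 ≤ z → |η z - lam n * z ^ (-delta n)| ≤ C₂ * z ^ (-(delta n + e)) := by
    rw [he, add_sub_cancel]; exact hC₂
  have hgain : mu n < delta n + 2 * e ∨ 2 * delta n + 1 < delta n + 2 * e := by
    rcases min_choice (delta n + 2) ((mu n + delta n + 1) / 2) with h | h
    · by_cases h2 : n = 2
      · left
        have h4 : delta n = 4 := by subst h2; norm_num [delta]
        rw [mu_lt_iff hn (by linarith), he, hp₁, h, h4, h2]
        norm_num
      · right
        have h3 : (3 : ℝ) ≤ n := by exact_mod_cast (by omega : 3 ≤ n)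
        have : delta n < 3 := by
          rw [delta, div_lt_iff₀ (by linarith)]; linarith
        rw [he, hp₁, h]; linarith
    · left; rw [he, hp₁, h]; linarith
  by_cases h5 : n ≤ 5
  · have hd' : delta' n = mu n := by rw [delta', if_pos h5, mu]
    have hμ5 := mu_lt_of_le_five hn h5
    have hgt : mu n < min (delta n + 2 * e) (2 * delta n + 1) :=
      lt_min (hgain.elim id (hμ5.trans ·)) hμ5
    obtain ⟨K₂, hK₂⟩ := hforce C₂ e _ (by linarith) (by linarith)
      (min_le_left (delta n + 2 * e) (2 * delta n + 1)) (min_le_right _ _) hC₂'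
    obtain ⟨L, hL⟩ := exists_tendsto_rpow_mul hdev hvlim hμ0 hgt hK₂
    refine ⟨L, ?_⟩
    have h0 := (hL.sub_const L).abs
    rw [sub_self, abs_zero] at h0
    refine h0.congr' ((eventually_gt_atTop 0).mono fun z hz => ?_)
    have hzz : z ^ mu n * z ^ (-mu n) = 1 := by rw [← Real.rpow_add hz]; simp
    have hzp : 0 < z ^ mu n := by positivity
    rw [hd']
    calc |z ^ mu n * (η z - lam n * z ^ (-delta n)) - L|
        = |z ^ mu n * (η z - (lam n * z ^ (-delta n) + L * z ^ (-mu n)))| := by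
          congr 1
          linear_combination L * hzz
      _ = _ := by rw [abs_mul, abs_of_pos hzp]
  · have h6 : 6 ≤ n := by omega
    have hd' : delta' n = 2 * delta n + 1 := by rw [delta', if_neg h5]
    have hμ6 := lt_mu_of_six_le h6
    obtain ⟨K₂, hK₂⟩ := exists_remainder_le hn (by linarith) (by linarith) hC₂'
    have hK₂0 : 0 ≤ K₂ := by simpa using (abs_nonneg _).trans (hK₂ 1 le_rfl)
    set q := 2 * delta n + 1 with hq
    set p := min (delta n + 2 * e) ((q + mu n) / 2) with hp
    have hpa : p ≤ delta n + 2 * e := min_le_left _ _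
    have hpb : p ≤ (q + mu n) / 2 := min_le_right _ _
    have hqp : q < p := lt_min (hgain.elim (hμ6.trans ·) id) (by linarith)
    have hNq : q * (q + 1) - mu n * (mu n + 1) < 0 := by nlinarith
    set D := B / (q * (q + 1) - mu n * (mu n + 1)) with hD
    have hDB : D * (q * (q + 1) - mu n * (mu n + 1)) = B := by
      rw [hD, div_mul_cancel₀ _ hNq.ne]
    have hdev2 := hdev.sub ((hasSecondDerivOn_rpow_neg q one_pos).const_mul D)
    have hlim2 := hvlim.sub (tendsto_mul_rpow_neg D (by linarith : 0 < q))
    rw [sub_zero] at hlim2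
    obtain ⟨C₃, hC₃⟩ := abs_le_mul_rpow_neg_of_slow (p := p) (K := K₂) (N := mu n * (mu n + 1))
      hdev2 hlim2 (by linarith) (by nlinarith) (fun z hz => by
        have hz0 : 0 < z := by linarith
        refine le_trans (le_of_eq ?_) ((hK₂ z hz).trans (mul_le_mul_of_nonneg_left
          (Real.rpow_le_rpow_of_exponent_le hz (by linarith)) hK₂0))
        congr 1
        rw [← hB, rpow_sub_two hz0 (-q)]
        rw [mu_mul_add_one hn] at hDB ⊢
        linear_combination (-(z ^ (-q) * z ^ (-2 : ℝ))) * hDB)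
    refine ⟨D, ?_⟩
    have hzero := tendsto_mul_rpow_neg C₃ (sub_pos.2 hqp)
    refine squeeze_zero' ((eventually_gt_atTop 0).mono fun z hz => by positivity)
      ((eventually_ge_atTop 1).mono fun z hz => ?_) hzero
    have hz0 : 0 < z := by linarith
    have h1 := hC₃ z hz
    rw [hd', ← sub_sub]
    calc _ ≤ z ^ q * (C₃ * z ^ (-p)) := by gcongr
      _ = C₃ * z ^ (-(p - q)) := by
        have : z ^ (-(p - q)) = z ^ q * z ^ (-p) := by rw [← Real.rpow_add hz0]; congr 1; ring
        rw [this]; ring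

end

/-! ### The expansion at zero -/

/-- Integrating a one-sided estimate `r' = o(z ^ k)` at `0`. -/
theorem isLittleO_pow_succ_of_deriv {r r' : ℝ → ℝ} {k : ℕ}
    (hr : ∀ z, 0 ≤ z → HasDerivWithinAt r (r' z) (Ici 0) z) (hr0 : r 0 = 0)
    (ho : r' =o[𝓝[≥] 0] fun z => z ^ k) : r =o[𝓝[≥] 0] fun z => z ^ (k + 1) := by
  rw [Asymptotics.isLittleO_iff] at ho ⊢
  intro ε hε
  obtain ⟨u, hu, hsub⟩ := mem_nhdsGE_iff_exists_Ico_subset.1 (ho hε)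
  refine mem_nhdsGE_iff_exists_Ico_subset.2 ⟨u, hu, fun z hz => ?_⟩
  have hb : ∀ y ∈ Icc 0 z, ‖r' y‖ ≤ ε * z ^ k := fun y hy => by
    have h1 : ‖r' y‖ ≤ ε * ‖y ^ k‖ := hsub ⟨hy.1, hy.2.trans_lt hz.2⟩
    rw [Real.norm_of_nonneg (pow_nonneg hy.1 k)] at h1
    have := pow_le_pow_left₀ hy.1 hy.2 k
    exact h1.trans (mul_le_mul_of_nonneg_left this hε.le)
  have := (convex_Icc 0 z).norm_image_sub_le_of_norm_hasDerivWithin_le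
    (fun y hy => (hr y hy.1).mono Icc_subset_Ici_self) hb (left_mem_Icc.2 hz.1)
    (right_mem_Icc.2 hz.1)
  rw [hr0, sub_zero, sub_zero, Real.norm_of_nonneg hz.1] at this
  simp only [mem_ofPred_eq]
  rw [Real.norm_of_nonneg (pow_nonneg hz.1 (k + 1)), pow_succ, ← mul_assoc]
  exact this

section

variable {n : ℕ} {η η' : ℝ → ℝ}

theorem hasSecondDerivOn_base (hη : HasSecondDerivOn η η' (fun z => source n z (η z)) 0) :
    HasSecondDerivOn (fun z => 2 * kappa * z * η z + η z ^ 2)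
      (fun z => 2 * kappa * η z + 2 * kappa * z * η' z + 2 * η z * η' z)
      (fun z => 2 * ((η' z + kappa) ^ 2 - kappa ^ 2 + (η z + kappa * z) * source n z (η z))) 0 := by
  intro z hz
  obtain ⟨h1, h2⟩ := hη z hz
  have hid : HasDerivWithinAt (fun z : ℝ => 2 * kappa * z) (2 * kappa) (Ici 0) z :=
    ((hasDerivAt_id z).const_mul (2 * kappa)).hasDerivWithinAt.congr_deriv (by simp)
  constructor
  · refine ((hid.fun_mul h1).fun_add (h1.fun_pow 2)).congr_deriv ?_
    push_cast
    ring
  · refine (((h1.const_mul (2 * kappa)).fun_add (hid.fun_mul h2)).fun_add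
      ((h1.const_mul 2).fun_mul h2)).congr_deriv ?_
    ring

/-- Fourth-order Taylor expansion at `0`, with coefficients computed from the equation. -/
theorem isLittleO_taylor (hn : 2 ≤ n)
    (hη : HasSecondDerivOn η η' (fun z => source n z (η z)) 0) (hη0 : η' 0 = -kappa) :
    (fun z => η z - (η 0 - kappa * z + η 0 ^ (2 * n) / 2 * z ^ 2 +
      n * η 0 ^ (2 * n - 2) * (η 0 ^ (2 * n + 1) - kappa ^ 2) / 12 * z ^ 4))
      =o[𝓝[≥] 0] fun z => z ^ 4 := by
  obtain ⟨m, rfl⟩ : ∃ m, n = m + 2 := ⟨n - 2, by omega⟩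
  set G := 2 * (((m + 2 : ℕ) : ℝ) * η 0 ^ (2 * (m + 2) - 2) *
    (η 0 ^ (2 * (m + 2) + 1) - kappa ^ 2)) with hG
  set q : ℝ → ℝ := fun z => 2 * kappa * z * η z + η z ^ 2 with hq
  set q' : ℝ → ℝ := fun z => 2 * kappa * η z + 2 * kappa * z * η' z + 2 * η z * η' z with hq'
  have hbase := hasSecondDerivOn_base hη
  have hq0 : q 0 = η 0 ^ 2 := by simp [hq]
  have hq'0 : q' 0 = 0 := by simp only [hq', hη0]; ring
  have hsrc0 : source (m + 2) 0 (η 0) = η 0 ^ (2 * (m + 2)) := by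
    simp [source, pow_mul]
  set g' : ℝ → ℝ := fun z => ((m + 2 : ℕ) : ℝ) * q z ^ (m + 1) * q' z with hg'
  have hsrc : ∀ z, 0 ≤ z →
      HasDerivWithinAt (fun z => source (m + 2) z (η z)) (g' z) (Ici 0) z := fun z hz =>
    (hbase z hz).1.fun_pow (m + 2)
  have hg'0 : HasDerivWithinAt g' G (Ici 0) 0 := by
    have := (((hbase 0 le_rfl).1.fun_pow (m + 1)).const_mul ((m + 2 : ℕ) : ℝ)).fun_mul
      (hbase 0 le_rfl).2
    refine this.congr_deriv ?_
    change _ * q' 0 + ((m + 2 : ℕ) : ℝ) * q 0 ^ (m + 1) * _ = G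
    beta_reduce
    rw [hq'0, hq0, hη0, hsrc0, hG, show 2 * (m + 2) - 2 = 2 * (m + 1) by omega, pow_mul]
    ring
  have h1 : (fun z => g' z - G * z) =o[𝓝[≥] 0] fun z => z ^ 1 := by
    have := hasDerivWithinAt_iff_isLittleO.1 hg'0
    have e0 : g' 0 = 0 := by simp [hg', hq'0]
    refine this.congr (fun z => ?_) (fun z => by simp)
    simp only [e0, sub_zero, smul_eq_mul]
    ring
  have hmon : ∀ (c : ℝ) (k : ℕ) (z : ℝ),
      HasDerivWithinAt (fun z => c * z ^ (k + 1)) (c * (k + 1) * z ^ k) (Ici 0) z := fun c k z =>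
    (((hasDerivAt_pow (k + 1) z).const_mul c).congr_deriv (by push_cast; ring)).hasDerivWithinAt
  have h2 := isLittleO_pow_succ_of_deriv
    (r := fun z => source (m + 2) z (η z) - η 0 ^ (2 * (m + 2)) - G / 2 * z ^ 2)
    (fun z hz => (((hsrc z hz).sub_const _).fun_sub (hmon (G / 2) 1 z)).congr_deriv
      (by push_cast; ring)) (by simp [hsrc0]) h1
  have h3 := isLittleO_pow_succ_of_deriv
    (r := fun z => η' z + kappa - η 0 ^ (2 * (m + 2)) * z ^ 1 - G / 6 * z ^ 3)
    (fun z hz => ((((hη z hz).2.add_const kappa).fun_sub (hmon _ 0 z)).fun_sub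
      (hmon (G / 6) 2 z)).congr_deriv (by push_cast; ring)) (by simp [hη0]) h2
  have h4 := isLittleO_pow_succ_of_deriv
    (r := fun z => η z - η 0 + kappa * z ^ 1 - η 0 ^ (2 * (m + 2)) / 2 * z ^ 2 - G / 24 * z ^ 4)
    (fun z hz => ((((((hη z hz).1.sub_const (η 0)).fun_add (hmon kappa 0 z)).fun_sub
      (hmon _ 1 z)).fun_sub (hmon (G / 24) 3 z))).congr_deriv (by push_cast; ring)) (by simp) h3
  refine h4.congr (fun z => ?_) (fun z => rfl)
  rw [hG]
  ring

/-- The sign of the fourth-order coefficient. If it were nonnegative, then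
`q = 2κzη + η²` would satisfy `q'' ≥ 0` wherever `q > q(0)`, so that `q ≤ q(0)` by the maximum
principle, since `q → 0` at infinity. But `q + κ²z² = (η + κz)²` and the Taylor expansion of `η`
make `q - q(0)` positive near `0`. -/
theorem pow_lt_kappa_sq (hn : 2 ≤ n)
    (hη : HasSecondDerivOn η η' (fun z => source n z (η z)) 0) (hη0 : η' 0 = -kappa)
    (hpos : ∀ z, 0 ≤ z → 0 < η z)
    (hlim : Tendsto (fun z => 2 * kappa * z * η z + η z ^ 2) atTop (𝓝 0)) :
    η 0 ^ (2 * n + 1) < kappa ^ 2 := by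
  by_contra hge
  push Not at hge
  have hκ := kappa_pos
  have h0 := hpos 0 le_rfl
  have hqle : ∀ z, 0 ≤ z → 2 * kappa * z * η z + η z ^ 2 - η 0 ^ 2 ≤ 0 := by
    intro z hz
    refine ((hasSecondDerivOn_base hη).sub_const (η 0 ^ 2)).nonpos_of_dirichlet
      (hlim.sub_const (η 0 ^ 2)) (by have := sq_nonneg (η 0); linarith) (fun y hy hφ => ?_)
      (by simp) hz
    have hy0 := hpos y hy
    have hw : η 0 ≤ η y + kappa * y := by
      refine le_of_sq_le_sq ?_ (by positivity)
      have : 0 ≤ (kappa * y) ^ 2 := sq_nonneg _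
      nlinarith
    have hs : η 0 ^ (2 * n) ≤ source n y (η y) := by
      rw [pow_mul, source]
      exact pow_le_pow_left₀ (sq_nonneg _) (by linarith) n
    have hprod : η 0 ^ (2 * n + 1) ≤ (η y + kappa * y) * source n y (η y) := by
      rw [pow_succ']
      gcongr
    have := sq_nonneg (η' y + kappa)
    linarith
  set a := η 0 ^ (2 * n) / 2 with ha
  have ha0 : 0 < a := by positivity
  have h2a : 2 * η 0 * a = η 0 ^ (2 * n + 1) := by rw [ha, pow_succ]; ring
  set d := n * η 0 ^ (2 * n - 2) * (η 0 ^ (2 * n + 1) - kappa ^ 2) / 12 with hd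
  have hd0 : 0 ≤ d := by
    have : 0 ≤ η 0 ^ (2 * n + 1) - kappa ^ 2 := by linarith
    positivity
  -- `ε` is small enough for the Taylor error to cost at most half of the term `a² z⁴`.
  set ε := a ^ 2 / (4 * (η 0 + a)) with hε
  have hε0 : 0 < ε := by positivity
  have hεa : 4 * (η 0 + a) * ε = a ^ 2 := by rw [hε]; field_simp
  have hev := (isLittleO_taylor hn hη hη0).def hε0
  obtain ⟨z, hzT, hz0, hz1⟩ := ((hev.filter_mono (nhdsWithin_mono 0 Ioi_subset_Ici_self)).and
    (Ioo_mem_nhdsGT (zero_lt_one (α := ℝ)))).exists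
  rw [Real.norm_of_nonneg (by positivity : 0 ≤ z ^ 4), Real.norm_eq_abs] at hzT
  have hlow := (abs_le.1 hzT).1
  rw [← ha, ← hd] at hlow
  have hz4 : 0 < z ^ 4 := by positivity
  set w := η z + kappa * z with hw
  set A := η 0 + a * z ^ 2 with hA
  have hA0 : 0 < A := by positivity
  have hAle : A ≤ η 0 + a := by
    have : z ^ 2 ≤ 1 := pow_le_one₀ hz0.le hz1.le
    have := mul_le_mul_of_nonneg_left this ha0.le
    linarith
  have hwA : A - ε * z ^ 4 ≤ w := by
    have := mul_nonneg hd0 hz4.le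
    linarith
  have hsq : A ^ 2 - 2 * A * (ε * z ^ 4) ≤ w ^ 2 := by
    have h1 := sq_nonneg (w - A)
    have h2 := mul_le_mul_of_nonneg_left hwA hA0.le
    linarith
  have herr : 2 * A * (ε * z ^ 4) ≤ a ^ 2 * z ^ 4 / 2 := by
    have := mul_le_mul_of_nonneg_right hAle (by positivity : 0 ≤ ε * z ^ 4)
    nlinarith
  have hq := hqle z hz0.le
  have hA2 : A ^ 2 = η 0 ^ 2 + η 0 ^ (2 * n + 1) * z ^ 2 + a ^ 2 * z ^ 4 := by
    rw [hA, ← h2a]; ring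
  have hk := mul_le_mul_of_nonneg_right hge (sq_nonneg z)
  have : 0 < a ^ 2 * z ^ 4 := by positivity
  linarith

end

end ReactionFront

theorem proposition3p1 (n : ℕ) (hn : 2 ≤ n) :
    ∃ η : ℝ → ℝ,
      -- existence and positivity
      ReactionFront.IsSolution n η ∧
      (∀ z, 0 ≤ z → 0 < η z) ∧
      -- uniqueness: among all positive solutions, and among all real solutions if `n` is even
      (∀ ζ : ℝ → ℝ, ReactionFront.IsSolution n ζ →
        (Even n ∨ ∀ z, 0 ≤ z → 0 < ζ z) → ∀ z, 0 ≤ z → ζ z = η z) ∧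
      -- expansion near zero
      (∃ η₀ η₂ η₄ : ℝ, 0 < η₀ ∧ 0 < η₂ ∧ 0 < η₄ ∧
        ReactionFront.HasExpansionAtZero η
          ![η₀, -ReactionFront.kappa, η₂, -η₄] ![0, 1, 2, 4]) ∧
      -- expansion near infinity
      (∃ lamInf : ℝ,
        ReactionFront.HasExpansionAtInfinity η
          ![ReactionFront.lam n, lamInf] ![ReactionFront.delta n, ReactionFront.delta' n]) := by
  have hδ := ReactionFront.delta_gt_one hn
  obtain ⟨η, η', A, hη, hη0, hb⟩ := ReactionFront.exists_pos_solution hn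
  have hpos : ∀ z, 0 ≤ z → 0 < η z := fun z hz => (hb z hz).1
  have hshift : Tendsto (fun z : ℝ => z + 1) atTop atTop :=
    tendsto_atTop_add_const_right _ 1 tendsto_id
  have hlim : Tendsto η atTop (𝓝 0) :=
    squeeze_zero' ((eventually_ge_atTop 0).mono fun z hz => (hpos z hz).le)
      ((eventually_ge_atTop 0).mono fun z hz => (hb z hz).2)
      ((tendsto_mul_rpow_neg A (by linarith : 0 < ReactionFront.delta n)).comp hshift)
  have hzlim : Tendsto (fun z => z * η z) atTop (𝓝 0) := by
    refine squeeze_zero' ((eventually_ge_atTop 0).mono fun z hz => mul_nonneg hz (hpos z hz).le)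
      ((eventually_ge_atTop 0).mono fun z hz => ?_)
      ((tendsto_mul_rpow_neg A (sub_pos.2 hδ)).comp hshift)
    have hz1 : 0 < z + 1 := by linarith
    calc z * η z ≤ (z + 1) * (A * (z + 1) ^ (-ReactionFront.delta n)) := by
          have := hpos z hz
          gcongr
          · linarith
          · exact (hb z hz).2
      _ = A * (z + 1) ^ (-(ReactionFront.delta n - 1)) := by
          rw [show -(ReactionFront.delta n - 1) = 1 + -ReactionFront.delta n by ring,
            Real.rpow_add hz1, Real.rpow_one]
          ring
  have hqlim : Tendsto (fun z => 2 * ReactionFront.kappa * z * η z + η z ^ 2) atTop (𝓝 0) := by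
    have := (hzlim.const_mul (2 * ReactionFront.kappa)).add (hlim.pow 2)
    simp only [mul_zero, ne_eq, OfNat.ofNat_ne_zero, not_false_eq_true, zero_pow,
      add_zero] at this
    exact this.congr fun z => by ring
  refine ⟨η, ⟨⟨η', fun z hz => (hη z hz).1, fun z hz => (hη z hz).2, hη0⟩, hlim⟩, hpos, ?_, ?_, ?_⟩
  · rintro ζ ⟨⟨ζ', hζ1, hζ2, hζ0⟩, hζlim⟩ hor z hz
    have hζ : HasSecondDerivOn ζ ζ' (fun z => ReactionFront.source n z (ζ z)) 0 :=
      fun z hz => ⟨hζ1 z hz, hζ2 z hz⟩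
    have hζpos : ∀ z, 0 ≤ z → 0 ≤ ζ z := by
      rcases hor with he | hp
      · exact fun z hz => ReactionFront.nonneg_of_convex hζ hζlim (fun y _ => he.pow_nonneg _) hz
      · exact fun z hz => (hp z hz).le
    exact le_antisymm
      (ReactionFront.le_of_nonneg_solutions hη hη0 hlim (fun z hz => (hpos z hz).le) hζ hζ0 hζlim hz)
      (ReactionFront.le_of_nonneg_solutions hζ hζ0 hζlim hζpos hη hη0 hlim hz)
  · have h0 := hpos 0 le_rfl
    have hlt := ReactionFront.pow_lt_kappa_sq hn hη hη0 hpos hqlim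
    refine ⟨η 0, η 0 ^ (2 * n) / 2,
      n * η 0 ^ (2 * n - 2) * (ReactionFront.kappa ^ 2 - η 0 ^ (2 * n + 1)) / 12, h0,
      by positivity, by have := sub_pos.2 hlt; positivity, ?_, ?_⟩
    · rw [Fin.strictMono_iff_lt_succ]
      intro i
      fin_cases i
      · exact zero_lt_one
      · exact one_lt_two
      · exact (by norm_num : (2 : ℝ) < 4)
    · have ht := ((ReactionFront.isLittleO_taylor hn hη hη0).mono
        (nhdsWithin_mono 0 Ioi_subset_Ici_self)).tendsto_div_nhds_zero.abs
      rw [abs_zero] at ht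
      refine ht.congr' (eventually_mem_nhdsWithin.mono fun z hz => ?_)
      have hz : 0 < z := hz
      have e4 : z ^ (4 : ℝ) = z ^ 4 := by exact_mod_cast Real.rpow_natCast z 4
      have e2 : z ^ (2 : ℝ) = z ^ 2 := by exact_mod_cast Real.rpow_natCast z 2
      rw [abs_div, abs_of_pos (by positivity : 0 < z ^ 4), div_eq_inv_mul, ← one_div]
      simp only [Fin.sum_univ_succ, Fin.last]
      simp [e4, e2]
      exact Or.inl (by congr 1; ring)
  · obtain ⟨L, hL⟩ := ReactionFront.exists_expansion_atTop hn hη hη0 hlim hpos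
    refine ⟨L, ?_, ?_⟩
    · rw [Fin.strictMono_iff_lt_succ]
      intro i
      fin_cases i
      exact ReactionFront.delta_lt_delta' hn
    · simpa [Fin.last] using hL
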